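/- **Setting.** Let $A,B,E$ be quantum systems with finite-dimensional Hilbert spaces, let $\mathcal N$ be a completely positive, trace-non-increasing map from operators on $A$ to operators on $B$, let $V:A\to B\otimes E$ be a Stinespring dilation of $\mathcal N$, i.e. $\mathcal N(\cdot)=\operatorname{tr}_E(V(\cdot)V^\dagger)$, let $\widehat{\mathcal N}(\cdot)=\operatorname{tr}_B(V(\cdot)V^\dagger)$ be the complementary map, and let $\{E_k\}$ be a finite family of Kraus operators, $\mathcal N(\cdot)=\sum_k E_k(\cdot)E_k^\dagger$. Let $|\psi\rangle,|\xi\rangle$ be vectors of $A$ with $\langle\psi|\psi\rangle=1$ and $\langle\psi|\xi\rangle=0$, and write $\psi=|\psi\rangle\langle\psi|$, $\rho_B=\mathcal N(\psi)$, $\rho_E=\widehat{\mathcal N}(\psi)$. For a Hermitian operator $O$, $P_O$ is the orthogonal projector onto its support and $P_O^\perp=\mathbb 1-P_O$; $\rho^{-1}$ is the Moore–Penrose pseudoinverse. Condition (ii) below refers to the following representation. Identify $B$ and $E$ with a common space $\mathbb C^d$ through partial isometries $J_B:B\to\mathbb C^d$ and $J_E:E\to\mathbb C^d$ whose initial spaces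 are large enough that $V|\psi\rangle$ and $V|\xi\rangle$ lie in their tensor product (for example, isometries into a common enlargement). Put $|\Phi\rangle=\sum_k|k\rangle|k\rangle\in\mathbb C^d\otimes\mathbb C^d$, let $\Lambda,M$ be the $d\times d$ matrices with $(J_B\otimes J_E)V|\psi\rangle=(\Lambda\otimes\mathbb 1)|\Phi\rangle$ and $(J_B\otimes J_E)V|\xi\rangle=(M\otimes\mathbb 1)|\Phi\rangle$, and let $\Lambda=\rho^{1/2}W$ be a polar decomposition with $W$ unitary, where $\rho=J_B\rho_BJ_B^\dagger$ is $\rho_B$ regarded as an operator on $\mathbb C^d$. **Proposition.** The following are equivalent (for (ii): for each choice of such a representation): 1. (i) $(P_{\rho_B}^\perp\otimes P_{\rho_E}^\perp)\,V|\xi\rangle=0$; 2. (ii) $P_{\rho}^\perp\, M W^\dagger P_{\rho}^\perp=0$; 3. (iii) $P_{\rho_B}^\perp\,\mathcal N(|\xi\rangle\langle\xi|)\,P_{\rho_B}^\perp=P_{\rho_B}^\perp\,\mathcal N(|\xi\rangle\langle\psi|)\,\rho_B^{-1}\,\mathcal N(|\psi\rangle\langle\xi|)\,P_{\rho_B}^\perp$;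 4. (iv) $P_{\rho_E}^\perp\,\widehat{\mathcal N}(|\xi\rangle\langle\xi|)\,P_{\rho_E}^\perp=P_{\rho_E}^\perp\,\widehat{\mathcal N}(|\xi\rangle\langle\psi|)\,\rho_E^{-1}\,\widehat{\mathcal N}(|\psi\rangle\langle\xi|)\,P_{\rho_E}^\perp$; 5. (v) for all $c_k\in\mathbb C$, if $E=\sum_k c_kE_k$ satisfies $E|\psi\rangle=0$, then $P_{\rho_B}^\perp E|\xi\rangle=0$. Suppose furthermore that $|\xi\rangle=(H-\langle\psi|H|\psi\rangle)|\psi\rangle$ for a Hermitian operator $H$, and that $t\mapsto|\psi(t)\rangle$ is a family of normalized state vectors around $t_0$ with $|\psi(t_0)\rangle=|\psi\rangle$ whose projector $\psi(t)=|\psi(t)\rangle\langle\psi(t)|$ is twice differentiable at $t_0$ with $\partial_t\psi(t_0)=-i[H,\psi]$. Let $\rho_B(t)=\mathcal N(\psi(t))$. Then (i)–(v) are also equivalent to 6. (vi) $\rho_B(t)$ does not change rank at $t_0$, which by definition means: each eigenvalue $p_k(t)$ of $\rho_B(t)$ with $p_k(t_0)=0$ satisfies $\partial_t^2p_k(t_0)=0$.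 This holds for either of the following readings of (vi): the $p_k(t)$ are the eigenvalues in decreasing order, and $\partial_t^2p_k(t_0)$ is the coefficient $m$ of the expansion $p_k(t)=p_k(t_0)+c\,(t-t_0)+\tfrac m2(t-t_0)^2+o((t-t_0)^2)$; or the $p_k(t)$ are any functions, twice differentiable at $t_0$, that list the eigenvalues of $\rho_B(t)$ with multiplicities for $t$ near $t_0$, and $\partial_t^2p_k(t_0)$ is the usual second derivative. -/

import Mathlib

open Matrix Filter Topology
open scoped Kronecker ComplexOrder

noncomputable section

namespace NoisyClock

/-! ### Matrices on finite-dimensional Hilbert spaces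

The systems `A`, `B`, `E` have Hilbert spaces `ℂ^a`, `ℂ^b`, `ℂ^e` for finite types `a`, `b`, `e`,
and `B ⊗ E` has the Hilbert space `ℂ^(b × e)`. -/

/-- The operator `|x⟩⟨y|`. -/
def ketbra {m n : Type*} (x : m → ℂ) (y : n → ℂ) : Matrix m n ℂ :=
  vecMulVec x (star y)

/-- The orthogonal projector `P_O` onto the support of the Hermitian operator `O`
(the spectral projector of the nonzero eigenvalues). -/
def suppProj {n : Type*} [Fintype n] [DecidableEq n] (O : Matrix n n ℂ) : Matrix n n ℂ :=
  cfc (fun x : ℝ => if x = 0 then (0 : ℝ) else 1) O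

/-- The complementary projector `P_O^⊥ = 1 - P_O`. -/
def kerProj {n : Type*} [Fintype n] [DecidableEq n] (O : Matrix n n ℂ) : Matrix n n ℂ :=
  1 - suppProj O

/-- The Moore-Penrose pseudoinverse of a Hermitian operator: the nonzero eigenvalues are
inverted, and the kernel is kept (in Lean, `(0 : ℝ)⁻¹ = 0`). -/
def pseudoInv {n : Type*} [Fintype n] [DecidableEq n] (O : Matrix n n ℂ) : Matrix n n ℂ :=
  cfc (fun x : ℝ => x⁻¹) O

/-- The square root of a positive semidefinite operator. -/
def psdSqrt {n : Type*} [Fintype n] [DecidableEq n] (O : Matrix n n ℂ) : Matrix n n ℂ :=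
  cfc Real.sqrt O

/-- The partial trace over `E`. -/
def traceE {b e : Type*} [Fintype e] (X : Matrix (b × e) (b × e) ℂ) : Matrix b b ℂ :=
  Matrix.of fun i j => ∑ k, X (i, k) (j, k)

/-- The partial trace over `B`. -/
def traceB {b e : Type*} [Fintype b] (X : Matrix (b × e) (b × e) ℂ) : Matrix e e ℂ :=
  Matrix.of fun i j => ∑ k, X (k, i) (k, j)

/-! ### Channels, dilations, Kraus operators -/

/-- The ampliation `id_n ⊗ N`, which applies `N` to each block. -/
def ampliation {a b : Type*} (N : Matrix a a ℂ →ₗ[ℂ] Matrix b b ℂ) (n : ℕ)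
    (X : Matrix (Fin n × a) (Fin n × a) ℂ) : Matrix (Fin n × b) (Fin n × b) ℂ :=
  Matrix.of fun p q => N (Matrix.of fun r s => X (p.1, r) (q.1, s)) p.2 q.2

/-- `N` is completely positive and trace non-increasing. -/
structure IsQuantumOperation {a b : Type*} [Fintype a] [Fintype b]
    (N : Matrix a a ℂ →ₗ[ℂ] Matrix b b ℂ) : Prop where
  completelyPositive : ∀ (n : ℕ) (X : Matrix (Fin n × a) (Fin n × a) ℂ),
    X.PosSemidef → (ampliation N n X).PosSemidef
  trace_le : ∀ X : Matrix a a ℂ, X.PosSemidef → (N X).trace.re ≤ X.trace.re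

/-- `V : A → B ⊗ E` is a Stinespring dilation of `N`: `N(X) = tr_E (V X V†)`. -/
def IsStinespring {a b e : Type*} [Fintype a] [Fintype e]
    (N : Matrix a a ℂ →ₗ[ℂ] Matrix b b ℂ) (V : Matrix (b × e) a ℂ) : Prop :=
  ∀ X, N X = traceE (V * X * Vᴴ)

/-- The complementary map `X ↦ tr_B (V X V†)` of the dilation `V`. -/
def complementary {a b e : Type*} [Fintype a] [Fintype b] (V : Matrix (b × e) a ℂ)
    (X : Matrix a a ℂ) : Matrix e e ℂ :=
  traceB (V * X * Vᴴ)

/-- `(K k)` is a family of Kraus operators of `N`: `N(X) = ∑ K_k X K_k†`. -/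
def IsKraus {a b κ : Type*} [Fintype a] [Fintype κ]
    (N : Matrix a a ℂ →ₗ[ℂ] Matrix b b ℂ) (K : κ → Matrix b a ℂ) : Prop :=
  ∀ X, N X = ∑ k, K k * X * (K k)ᴴ

/-- The unnormalized maximally entangled ket `∑ |k⟩|k⟩` on `ℂ^d ⊗ ℂ^d`. -/
def maxEntangled (d : Type*) [DecidableEq d] : d × d → ℂ :=
  fun p => if p.1 = p.2 then 1 else 0

/-- A representation of the vectors `V|ψ⟩` and `V|ξ⟩` of `B ⊗ E` by matrices `Λ` and `M` through
a maximally entangled ket `|Φ⟩` on `ℂ^d ⊗ ℂ^d`, with `W` from the polar decomposition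
`Λ = ρ^{1/2} W`. The spaces `B` and `E` are identified with `ℂ^d` through partial isometries
`JB`, `JE`; so `ℂ^d` may be a common enlargement of `B` and `E`, or may be identified with
subspaces of them, which have to be large enough to support `V|ψ⟩` and `V|ξ⟩`.
In `ℂ^d`, the state `ρ` of `B` is `JB ρ JB†`. -/
structure EntangledRep {a b e : Type*} [Fintype a] [Fintype b] [Fintype e]
    (V : Matrix (b × e) a ℂ) (ψ ξ : a → ℂ) (ρ : Matrix b b ℂ)
    (d : Type*) [Fintype d] [DecidableEq d] where
  JB : Matrix d b ℂ
  JE : Matrix d e ℂ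
  JB_partialIsometry : JB * JBᴴ * JB = JB
  JE_partialIsometry : JE * JEᴴ * JE = JE
  support_ψ : ((JBᴴ * JB) ⊗ₖ (JEᴴ * JE)) *ᵥ (V *ᵥ ψ) = V *ᵥ ψ
  support_ξ : ((JBᴴ * JB) ⊗ₖ (JEᴴ * JE)) *ᵥ (V *ᵥ ξ) = V *ᵥ ξ
  Λ : Matrix d d ℂ
  M : Matrix d d ℂ
  W : Matrix d d ℂ
  Λ_spec : (JB ⊗ₖ JE) *ᵥ (V *ᵥ ψ) = (Λ ⊗ₖ (1 : Matrix d d ℂ)) *ᵥ maxEntangled d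
  M_spec : (JB ⊗ₖ JE) *ᵥ (V *ᵥ ξ) = (M ⊗ₖ (1 : Matrix d d ℂ)) *ᵥ maxEntangled d
  W_unitary : W ∈ Matrix.unitaryGroup d ℂ
  polar : Λ = psdSqrt (JB * ρ * JBᴴ) * W

/-! ### Time evolution and eigenvalues -/

/-- `f` is twice differentiable at `t₀`. -/
def TwiceDifferentiableAt {F : Type*} [NormedAddCommGroup F] [NormedSpace ℝ F]
    (f : ℝ → F) (t₀ : ℝ) : Prop :=
  (∀ᶠ t in 𝓝 t₀, DifferentiableAt ℝ f t) ∧ DifferentiableAt ℝ (deriv f) t₀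

/-- `f` has the second derivative `m` at `t₀`, in the sense of the second-order expansion
`f(t) = f(t₀) + c (t - t₀) + (m / 2) (t - t₀)² + o((t - t₀)²)`. For functions that are twice
differentiable at `t₀` this says that `f''(t₀) = m`. -/
def HasSecondDerivAt (f : ℝ → ℝ) (m t₀ : ℝ) : Prop :=
  ∃ c : ℝ, (fun t => f t - (f t₀ + c * (t - t₀) + m / 2 * (t - t₀) ^ 2))
    =o[𝓝 t₀] fun t => (t - t₀) ^ 2

/-- The expectation value `⟨ψ|H|ψ⟩`. -/
def expVal {a : Type*} [Fintype a] (H : Matrix a a ℂ) (ψ : a → ℂ) : ℂ :=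
  star ψ ⬝ᵥ (H *ᵥ ψ)

/-- `t ↦ |φ(t)⟩` is a family of normalized state vectors around `t₀`, with `|φ(t₀)⟩ = |ψ⟩`, whose
projector `φ(t) = |φ(t)⟩⟨φ(t)|` is twice differentiable at `t₀` and satisfies
`∂_t φ = -i [H, φ]` at `t₀`. -/
structure IsEvolution {a : Type*} [Fintype a]
    (H : Matrix a a ℂ) (φ : ℝ → a → ℂ) (t₀ : ℝ) (ψ : a → ℂ) : Prop where
  initial : φ t₀ = ψ
  normalized : ∀ᶠ t in 𝓝 t₀, star (φ t) ⬝ᵥ φ t = 1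
  twiceDiff : ∀ i j, TwiceDifferentiableAt (fun t => ketbra (φ t) (φ t) i j) t₀
  schrodinger : ∀ i j, HasDerivAt (fun t => ketbra (φ t) (φ t) i j)
    ((-Complex.I • (H * ketbra ψ ψ - ketbra ψ ψ * H)) i j) t₀

/-- The eigenvalues of a Hermitian matrix with multiplicities, in decreasing order. -/
def sortedEigenvalue {n : Type*} [Fintype n] [DecidableEq n] (O : Matrix n n ℂ)
    (k : Fin (Fintype.card n)) : ℝ :=
  open Classical in if h : O.IsHermitian then h.eigenvalues₀ k else 0

/-- The functions `p k` list, with multiplicities, the eigenvalues of `ρ t` for `t` near `t₀`,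
and are twice differentiable at `t₀`. -/
structure IsEigenvalueFamily {n : Type*} [Fintype n] [DecidableEq n]
    (ρ : ℝ → Matrix n n ℂ) (t₀ : ℝ) (p : n → ℝ → ℝ) : Prop where
  charpoly_eq : ∀ᶠ t in 𝓝 t₀,
    (ρ t).charpoly = ∏ k, (Polynomial.X - Polynomial.C ((p k t : ℝ) : ℂ))
  twiceDiff : ∀ k, TwiceDifferentiableAt (p k) t₀

/-! ### The conditions -/

section Conditions

variable {a b e κ : Type*} [Fintype a] [Fintype b] [DecidableEq b] [Fintype e] [DecidableEq e]
  [Fintype κ]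

/-- `(P_{ρ_B}^⊥ ⊗ P_{ρ_E}^⊥) V|ξ⟩ = 0`. -/
def ProjectionCondition (N : Matrix a a ℂ →ₗ[ℂ] Matrix b b ℂ) (V : Matrix (b × e) a ℂ)
    (ψ ξ : a → ℂ) : Prop :=
  (kerProj (N (ketbra ψ ψ)) ⊗ₖ kerProj (complementary V (ketbra ψ ψ))) *ᵥ (V *ᵥ ξ) = 0

/-- `P_{ρ_B}^⊥ M W† P_{ρ_B}^⊥ = 0`. -/
def PolarCondition {V : Matrix (b × e) a ℂ} {ψ ξ : a → ℂ} {ρ : Matrix b b ℂ}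
    {d : Type*} [Fintype d] [DecidableEq d] (R : EntangledRep V ψ ξ ρ d) : Prop :=
  kerProj (R.JB * ρ * R.JBᴴ) * R.M * R.Wᴴ * kerProj (R.JB * ρ * R.JBᴴ) = 0

/-- The Schur complement condition of a map `F`, with `ρ = F(|ψ⟩⟨ψ|)`:
`P_ρ^⊥ F(|ξ⟩⟨ξ|) P_ρ^⊥ = P_ρ^⊥ F(|ξ⟩⟨ψ|) ρ⁻¹ F(|ψ⟩⟨ξ|) P_ρ^⊥`. -/
def SchurCondition (F : Matrix a a ℂ → Matrix b b ℂ) (ψ ξ : a → ℂ) : Prop :=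
  kerProj (F (ketbra ψ ψ)) * F (ketbra ξ ξ) * kerProj (F (ketbra ψ ψ)) =
    kerProj (F (ketbra ψ ψ)) * F (ketbra ξ ψ) * pseudoInv (F (ketbra ψ ψ)) *
      F (ketbra ψ ξ) * kerProj (F (ketbra ψ ψ))

/-- Each combination `∑ c_k K_k` that annihilates `|ψ⟩` satisfies
`P_{ρ_B}^⊥ (∑ c_k K_k) |ξ⟩ = 0`. -/
def KrausCondition (N : Matrix a a ℂ →ₗ[ℂ] Matrix b b ℂ) (K : κ → Matrix b a ℂ)
    (ψ ξ : a → ℂ) : Prop :=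
  ∀ c : κ → ℂ, (∑ k, c k • K k) *ᵥ ψ = 0 →
    kerProj (N (ketbra ψ ψ)) *ᵥ ((∑ k, c k • K k) *ᵥ ξ) = 0

/-- The curve `ρ` does not change rank at `t₀`: each of its eigenvalues (in decreasing order)
that vanishes at `t₀` has second derivative `0` there. -/
def NoRankChange (ρ : ℝ → Matrix b b ℂ) (t₀ : ℝ) : Prop :=
  ∀ k, sortedEigenvalue (ρ t₀) k = 0 → HasSecondDerivAt (fun t => sortedEigenvalue (ρ t) k) 0 t₀

end Conditions

end NoisyClock

end

open NoisyClock

/-!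
The vectors `V|ψ⟩` and `V|ξ⟩` of `B ⊗ E` are the matrices `X` and `Y` of their coefficients, and
then `N(|u⟩⟨v|)` is the product `X_u X_v†`; the complementary map and the Kraus operators give the
same formula for `Xᵀ` and for the matrix with the columns `K_k|ψ⟩`. Each algebraic condition says
that `Y` is tangent at `X` to the matrices with the rank of `X`, that is, the compression of `Y`
from the kernel of `X` to the kernel of `X†` vanishes (`IsRankTangent`). For the projection and
Kraus conditions this is a matter of identifying the kernels. In the Schur condition,
`X† (X X†)⁻¹ X` is the projector onto the range of `X†`, so that the difference of the two sides
has the form `Z Z†` with `Z = P Y (1 - X† (X X†)⁻¹ X)` (`isRankTangent_iff_schur`). In the polar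
condition, `W†` carries the kernel of `ρ` onto the kernel of `Λ`. Tangency of `(X, Y)` and of the
transposed pair are equivalent, and so are tangency of `(X, Y)` and of the pair that belongs to
another factorization of `N`, because both are equivalent to the Schur condition of `N`.

The change of rank is treated without second-order perturbation theory. The vectors
`|φ(t)⟩⟨φ(t)|ψ⟩`, which depend differentiably on `t` and have the derivative `-i|ξ⟩`, differ from
`|φ(t)⟩` by factors whose modulus tends to `1`. So the eigenvalues of `ρ_B(t)` are, up to such
factors, squares of singular values of a curve `X(t)` with the derivative `-i Y`, and it is enough
to perturb the kernel of `X(t)†` to first order: `X(t)†` is `o(t - t₀)` on subspaces with the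
dimension of the kernel of `X†` if and only if `Y†` maps the kernel of `X†` to the range of `X†`
(`kernelPersists_iff`). By counting dimensions as in the Courant–Fischer principle, such subspaces
exist if and only if the eigenvalues that vanish at `t₀` are `o((t - t₀)²)`
(`kernelPersists_iff_eigenvalues`). As the eigenvalues are nonnegative, this is the vanishing of
their second derivatives, in both readings.
-/

namespace NoisyClock

/-! ### Support projector and pseudoinverse -/

section FunctionalCalculus

variable {n m : Type*} [Fintype n] [DecidableEq n] [Fintype m]

lemma cfc_isHermitian (f : ℝ → ℝ) (O : Matrix n n ℂ) : (cfc f O).IsHermitian :=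
  (cfc_predicate f O : IsSelfAdjoint _)

lemma kerProj_isHermitian (O : Matrix n n ℂ) : (kerProj O).IsHermitian :=
  isHermitian_one.sub (cfc_isHermitian _ O)

lemma mul_pseudoInv {O : Matrix n n ℂ} (hO : O.IsHermitian) : O * pseudoInv O = suppProj O := by
  have hsa : IsSelfAdjoint O := hO
  have hf := O.finite_real_spectrum
  have h := cfc_mul (fun x : ℝ => x) (fun x => x⁻¹) O (hf.continuousOn _) (hf.continuousOn _)
  rw [cfc_id' ℝ O] at h
  rw [pseudoInv, suppProj, ← h]
  congr 1
  ext x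
  by_cases hx : x = 0 <;> simp [hx]

lemma mul_kerProj_of_conjTranspose (X : Matrix n m ℂ) :
    Xᴴ * kerProj (X * Xᴴ) = 0 := by
  have hO := isHermitian_mul_conjTranspose_self X
  have hsa : IsSelfAdjoint (X * Xᴴ) := hO
  have h1 : (X * Xᴴ) * kerProj (X * Xᴴ) = 0 := by
    have hf := (X * Xᴴ).finite_real_spectrum
    have h := cfc_mul (fun x : ℝ => x) (fun x => if x = 0 then (0 : ℝ) else 1) (X * Xᴴ)
      (hf.continuousOn _) (hf.continuousOn _)
    rw [cfc_id' ℝ (X * Xᴴ)] at h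
    have h2 : (fun x : ℝ => x * if x = 0 then (0 : ℝ) else 1) = fun x => x := by
      ext x
      by_cases hx : x = 0 <;> simp [hx]
    rw [h2, cfc_id' ℝ (X * Xᴴ)] at h
    rw [kerProj, mul_sub, mul_one, suppProj, ← h, sub_self]
  rw [← conjTranspose_mul_self_eq_zero, conjTranspose_mul, conjTranspose_conjTranspose,
    Matrix.mul_assoc, ← Matrix.mul_assoc X, h1, Matrix.mul_zero]

lemma kerProj_mul_self (X : Matrix n m ℂ) : kerProj (X * Xᴴ) * X = 0 := by
  have h := congrArg conjTranspose (mul_kerProj_of_conjTranspose X)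
  rwa [conjTranspose_mul, conjTranspose_conjTranspose, (kerProj_isHermitian _).eq,
    conjTranspose_zero] at h

lemma mul_pseudoInv_eq_one_sub (X : Matrix n m ℂ) :
    X * Xᴴ * pseudoInv (X * Xᴴ) = 1 - kerProj (X * Xᴴ) := by
  rw [mul_pseudoInv (isHermitian_mul_conjTranspose_self X), kerProj, sub_sub_cancel]

lemma kerProj_mulVec_of_conjTranspose {X : Matrix n m ℂ} {u : n → ℂ} (hu : Xᴴ *ᵥ u = 0) :
    kerProj (X * Xᴴ) *ᵥ u = u := by
  have h := congrArg conjTranspose (mul_pseudoInv_eq_one_sub X)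
  rw [conjTranspose_mul, (isHermitian_mul_conjTranspose_self X).eq, conjTranspose_sub,
    conjTranspose_one, (kerProj_isHermitian _).eq] at h
  have h2 := congrArg (· *ᵥ u) h
  simp only [sub_mulVec, one_mulVec] at h2
  rw [← mulVec_mulVec, ← mulVec_mulVec, hu, mulVec_zero, mulVec_zero] at h2
  exact (sub_eq_zero.mp h2.symm).symm

variable [DecidableEq m]

/-- The orthogonal projector `1 - X† (X X†)⁻¹ X` onto the kernel of `X`. -/
noncomputable def rightKerProj (X : Matrix n m ℂ) : Matrix m m ℂ :=
  1 - Xᴴ * pseudoInv (X * Xᴴ) * X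

lemma rightKerProj_isHermitian (X : Matrix n m ℂ) : (rightKerProj X).IsHermitian := by
  refine isHermitian_one.sub ?_
  rw [IsHermitian, conjTranspose_mul, conjTranspose_mul, conjTranspose_conjTranspose,
    pseudoInv, (cfc_isHermitian _ _).eq, Matrix.mul_assoc]

lemma mul_rightKerProj (X : Matrix n m ℂ) : X * rightKerProj X = 0 := by
  rw [rightKerProj, Matrix.mul_sub, Matrix.mul_one, ← Matrix.mul_assoc, ← Matrix.mul_assoc,
    mul_pseudoInv_eq_one_sub, Matrix.sub_mul, Matrix.one_mul, kerProj_mul_self, sub_zero, sub_self]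

lemma rightKerProj_mul_self (X : Matrix n m ℂ) :
    rightKerProj X * rightKerProj X = rightKerProj X := by
  conv_lhs => enter [1]; rw [rightKerProj]
  rw [Matrix.sub_mul, Matrix.mul_assoc, mul_rightKerProj, Matrix.mul_zero, sub_zero,
    Matrix.one_mul]

lemma rightKerProj_mulVec {X : Matrix n m ℂ} {v : m → ℂ} (hv : X *ᵥ v = 0) :
    rightKerProj X *ᵥ v = v := by
  rw [rightKerProj, sub_mulVec, one_mulVec, ← mulVec_mulVec, hv, mulVec_zero, sub_zero]

end FunctionalCalculus

/-! ### Tangency to the matrices of fixed rank -/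

/-- `Y` is tangent at `X` to the variety of matrices with the rank of `X`: its compression from
the kernel of `X` to the cokernel of `X` vanishes. -/
def IsRankTangent {m n : Type*} [Fintype m] [Fintype n] (X Y : Matrix m n ℂ) : Prop :=
  ∀ u v, Xᴴ *ᵥ u = 0 → X *ᵥ v = 0 → star u ⬝ᵥ (Y *ᵥ v) = 0

section Tangent

variable {m n : Type*} [Fintype m] [Fintype n]

lemma star_mulVec_dotProduct {k l : Type*} [Fintype k] [Fintype l] (A : Matrix k l ℂ)
    (u : l → ℂ) (v : k → ℂ) : star (A *ᵥ u) ⬝ᵥ v = star u ⬝ᵥ (Aᴴ *ᵥ v) := by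
  rw [star_mulVec, dotProduct_mulVec]

omit [Fintype m] in
lemma conjTranspose_transpose_mulVec_eq_zero (X : Matrix m n ℂ) (u : n → ℂ) :
    Xᵀᴴ *ᵥ u = 0 ↔ X *ᵥ star u = 0 := by
  rw [mulVec_conjTranspose, vecMul_transpose, star_eq_zero]

lemma IsRankTangent.transpose {X Y : Matrix m n ℂ} (h : IsRankTangent X Y) :
    IsRankTangent Xᵀ Yᵀ := by
  intro u v hu hv
  have hv' : Xᴴ *ᵥ star v = 0 := by
    rw [mulVec_conjTranspose, star_star, ← mulVec_transpose, hv, star_zero]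
  have := h (star v) (star u) hv' ((conjTranspose_transpose_mulVec_eq_zero X u).mp hu)
  rwa [star_star, dotProduct_mulVec, dotProduct_comm, ← mulVec_transpose] at this

lemma isRankTangent_transpose_iff {X Y : Matrix m n ℂ} :
    IsRankTangent Xᵀ Yᵀ ↔ IsRankTangent X Y :=
  ⟨fun h => h.transpose, fun h => h.transpose⟩

/-- Tangency passes from `(X, Y)` to a pair `(X', Y')` when `Y'` is obtained from `Y` by maps that
carry the kernels of `X'` and of its adjoint into those of `X` and of its adjoint. -/
lemma IsRankTangent.of_compression {m' n' : Type*} [Fintype m'] [Fintype n']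
    {X Y : Matrix m n ℂ} {X' Y' : Matrix m' n' ℂ} (h : IsRankTangent X Y)
    (S : Matrix m m' ℂ) (T : Matrix n n' ℂ) (hY : Y' = Sᴴ * Y * T)
    (hS : ∀ u, X'ᴴ *ᵥ u = 0 → Xᴴ *ᵥ (S *ᵥ u) = 0) (hT : ∀ v, X' *ᵥ v = 0 → X *ᵥ (T *ᵥ v) = 0) :
    IsRankTangent X' Y' := by
  intro u v hu hv
  have := h _ _ (hS u hu) (hT v hv)
  rwa [star_mulVec_dotProduct, mulVec_mulVec, mulVec_mulVec, ← hY] at this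

variable [DecidableEq m]

lemma isRankTangent_iff_mulVec {X Y : Matrix m n ℂ} :
    IsRankTangent X Y ↔ ∀ v, X *ᵥ v = 0 → kerProj (X * Xᴴ) *ᵥ (Y *ᵥ v) = 0 := by
  classical
  constructor
  · intro h v hv
    refine dotProduct_star_self_eq_zero.mp ?_
    rw [dotProduct_mulVec, ← star_star (star _ ᵥ* _), star_vecMul, star_star,
      (kerProj_isHermitian _).eq]
    refine h _ _ ?_ hv
    rw [mulVec_mulVec, mulVec_mulVec, mul_kerProj_of_conjTranspose,
      Matrix.zero_mul, zero_mulVec]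
  · intro h u v hu hv
    rw [← kerProj_mulVec_of_conjTranspose hu, star_mulVec_dotProduct,
      (kerProj_isHermitian _).eq, h v hv, dotProduct_zero]

/-- Tangency, with the kernel of `X` given by any matrix `Q` whose range it is. -/
lemma isRankTangent_iff_mul_eq_zero {k : Type*} [Fintype k] [DecidableEq k] {X Y : Matrix m n ℂ}
    {Q : Matrix n k ℂ} (hXQ : X * Q = 0) (hQ : ∀ v, X *ᵥ v = 0 → ∃ w, Q *ᵥ w = v) :
    IsRankTangent X Y ↔ kerProj (X * Xᴴ) * Y * Q = 0 := by
  rw [isRankTangent_iff_mulVec]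
  constructor
  · intro h
    refine ext_of_mulVec_single fun i => ?_
    rw [← mulVec_mulVec, ← mulVec_mulVec, h, zero_mulVec]
    rw [mulVec_mulVec, hXQ, zero_mulVec]
  · intro h v hv
    obtain ⟨w, rfl⟩ := hQ v hv
    rw [mulVec_mulVec, mulVec_mulVec, h, zero_mulVec]

/-- The Schur complement of `X X†` in the matrix of products vanishes exactly on tangent
directions, because `X† (X X†)⁻¹ X` is the projector onto the range of `X†`. -/
lemma isRankTangent_iff_schur {X Y : Matrix m n ℂ} :
    IsRankTangent X Y ↔ kerProj (X * Xᴴ) * (Y * Yᴴ) * kerProj (X * Xᴴ) =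
      kerProj (X * Xᴴ) * (Y * Xᴴ) * pseudoInv (X * Xᴴ) * (X * Yᴴ) * kerProj (X * Xᴴ) := by
  classical
  rw [isRankTangent_iff_mul_eq_zero (mul_rightKerProj X)
    fun v hv => ⟨v, rightKerProj_mulVec hv⟩, ← self_mul_conjTranspose_eq_zero,
    ← sub_eq_zero (b := _ * _ * _)]
  simp only [conjTranspose_mul, (rightKerProj_isHermitian X).eq, (kerProj_isHermitian _).eq]
  have h : kerProj (X * Xᴴ) * Y * rightKerProj X * (rightKerProj X * (Yᴴ * kerProj (X * Xᴴ))) =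
      kerProj (X * Xᴴ) * Y * (rightKerProj X * rightKerProj X) * (Yᴴ * kerProj (X * Xᴴ)) := by
    simp only [Matrix.mul_assoc]
  rw [h, rightKerProj_mul_self, rightKerProj]
  simp only [Matrix.mul_sub, Matrix.sub_mul, Matrix.mul_one, Matrix.mul_assoc]

end Tangent

/-! ### Coefficient matrices of bipartite vectors -/

/-- The matrix of coefficients `x (i, k)` of a vector `x` of `B ⊗ E`. -/
def coeffMatrix {b e : Type*} (x : b × e → ℂ) : Matrix b e ℂ :=
  Matrix.of fun i k => x (i, k)

section Coefficients

variable {a b e κ : Type*}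

lemma vec_transpose_coeffMatrix (x : b × e → ℂ) : vec (coeffMatrix x)ᵀ = x := rfl

lemma coeffMatrix_injective : Function.Injective (coeffMatrix (b := b) (e := e)) := by
  intro x y h
  rw [← vec_transpose_coeffMatrix x, h, vec_transpose_coeffMatrix]

lemma coeffMatrix_smul (c : ℂ) (x : b × e → ℂ) : coeffMatrix (c • x) = c • coeffMatrix x := rfl

lemma coeffMatrix_kronecker_mulVec {b' e' : Type*} [Fintype b] [Fintype e]
    (S : Matrix b' b ℂ) (T : Matrix e' e ℂ) (x : b × e → ℂ) :
    coeffMatrix ((S ⊗ₖ T) *ᵥ x) = S * coeffMatrix x * Tᵀ := by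
  rw [← vec_transpose_coeffMatrix x, kronecker_mulVec_vec]
  ext i k
  rw [vec_transpose_coeffMatrix, coeffMatrix, of_apply, vec, ← transpose_apply (_ * _)]
  simp only [transpose_mul, transpose_transpose, Matrix.mul_assoc]

lemma coeffMatrix_maxEntangled (d : Type*) [DecidableEq d] : coeffMatrix (maxEntangled d) = 1 := by
  ext i k
  simp [coeffMatrix, maxEntangled, one_apply]

lemma mul_ketbra_mul_conjTranspose {m : Type*} [Fintype a] (V : Matrix m a ℂ) (x y : a → ℂ) :
    V * ketbra x y * Vᴴ = ketbra (V *ᵥ x) (V *ᵥ y) := by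
  rw [ketbra, ketbra, mul_vecMulVec, vecMulVec_mul, star_mulVec]

lemma traceE_ketbra [Fintype e] (x y : b × e → ℂ) :
    traceE (ketbra x y) = coeffMatrix x * (coeffMatrix y)ᴴ := by
  ext i j
  simp [traceE, ketbra, coeffMatrix, mul_apply, vecMulVec_apply]

lemma traceB_ketbra [Fintype b] (x y : b × e → ℂ) :
    traceB (ketbra x y) = (coeffMatrix x)ᵀ * ((coeffMatrix y)ᵀ)ᴴ := by
  ext i j
  simp [traceB, ketbra, coeffMatrix, mul_apply, vecMulVec_apply]

variable [Fintype a] {N : Matrix a a ℂ →ₗ[ℂ] Matrix b b ℂ} {V : Matrix (b × e) a ℂ}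

lemma IsStinespring.apply_ketbra [Fintype e] (hV : IsStinespring N V) (x y : a → ℂ) :
    N (ketbra x y) = coeffMatrix (V *ᵥ x) * (coeffMatrix (V *ᵥ y))ᴴ := by
  rw [hV, mul_ketbra_mul_conjTranspose, traceE_ketbra]

lemma complementary_ketbra [Fintype b] (V : Matrix (b × e) a ℂ) (x y : a → ℂ) :
    complementary V (ketbra x y) = (coeffMatrix (V *ᵥ x))ᵀ * ((coeffMatrix (V *ᵥ y))ᵀ)ᴴ := by
  rw [complementary, mul_ketbra_mul_conjTranspose, traceB_ketbra]

/-- The matrix with the columns `K_k x`. It plays the part of the coefficient matrix for the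
dilation that belongs to the Kraus operators `K_k`. -/
def krausMatrix (K : κ → Matrix b a ℂ) (x : a → ℂ) : Matrix b κ ℂ :=
  Matrix.of fun i k => (K k *ᵥ x) i

lemma krausMatrix_mulVec [Fintype κ] (K : κ → Matrix b a ℂ) (x : a → ℂ) (c : κ → ℂ) :
    krausMatrix K x *ᵥ c = (∑ k, c k • K k) *ᵥ x := by
  ext i
  simp only [sum_mulVec, smul_mulVec, Finset.sum_apply, Pi.smul_apply, smul_eq_mul]
  exact Finset.sum_congr rfl fun k _ => mul_comm _ _

lemma IsKraus.apply_ketbra [Fintype κ] {K : κ → Matrix b a ℂ} (hK : IsKraus N K) (x y : a → ℂ) :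
    N (ketbra x y) = krausMatrix K x * (krausMatrix K y)ᴴ := by
  rw [hK]
  ext i j
  rw [Matrix.sum_apply, mul_apply]
  refine Finset.sum_congr rfl fun k _ => ?_
  rw [mul_ketbra_mul_conjTranspose]
  rfl

end Coefficients

/-! ### The algebraic conditions -/

section Conditions

variable {a b e κ d : Type*} [Fintype a] [Fintype b] [DecidableEq b]
  {N : Matrix a a ℂ →ₗ[ℂ] Matrix b b ℂ} {ψ ξ : a → ℂ}

omit [Fintype a] in
lemma schurCondition_iff {m : Type*} [Fintype m] {F : Matrix a a ℂ → Matrix b b ℂ}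
    {C : (a → ℂ) → Matrix b m ℂ} (hF : ∀ x y, F (ketbra x y) = C x * (C y)ᴴ) :
    SchurCondition F ψ ξ ↔ IsRankTangent (C ψ) (C ξ) := by
  rw [isRankTangent_iff_schur, SchurCondition, hF, hF, hF, hF]

lemma krausCondition_iff [Fintype κ] {K : κ → Matrix b a ℂ} (hK : IsKraus N K) :
    KrausCondition N K ψ ξ ↔ IsRankTangent (krausMatrix K ψ) (krausMatrix K ξ) := by
  rw [isRankTangent_iff_mulVec, KrausCondition, hK.apply_ketbra]
  simp only [krausMatrix_mulVec]

variable [Fintype e] {V : Matrix (b × e) a ℂ}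

lemma projectionCondition_iff [DecidableEq e] (hV : IsStinespring N V) :
    ProjectionCondition N V ψ ξ ↔
      IsRankTangent (coeffMatrix (V *ᵥ ψ)) (coeffMatrix (V *ᵥ ξ)) := by
  set X := coeffMatrix (V *ᵥ ψ)
  -- The transpose of the projector onto the kernel of `ρ_E` has the kernel of `X` as its range.
  rw [isRankTangent_iff_mul_eq_zero (Q := (kerProj (Xᵀ * Xᵀᴴ))ᵀ), ProjectionCondition,
    hV.apply_ketbra, complementary_ketbra, ← coeffMatrix_injective.eq_iff,
    coeffMatrix_kronecker_mulVec]
  · rfl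
  · have h := congrArg transpose (kerProj_mul_self Xᵀ)
    rwa [transpose_mul, transpose_transpose, transpose_zero] at h
  · intro v hv
    refine ⟨v, ?_⟩
    have h : kerProj (Xᵀ * Xᵀᴴ) *ᵥ star v = star v :=
      kerProj_mulVec_of_conjTranspose
        ((conjTranspose_transpose_mulVec_eq_zero X _).mpr (by rwa [star_star]))
    rw [mulVec_transpose, ← star_star (v ᵥ* _), star_vecMul, (kerProj_isHermitian _).eq, h,
      star_star]

end Conditions

/-! ### Representation through a maximally entangled ket -/

namespace EntangledRep

variable {a b e d : Type*} [Fintype a] [Fintype b] [Fintype e] [Fintype d] [DecidableEq d]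
  {V : Matrix (b × e) a ℂ} {ψ ξ : a → ℂ} {ρ : Matrix b b ℂ} (R : EntangledRep V ψ ξ ρ d)

lemma Λ_eq : R.Λ = R.JB * coeffMatrix (V *ᵥ ψ) * R.JEᵀ := by
  have h := congrArg coeffMatrix R.Λ_spec
  rw [coeffMatrix_kronecker_mulVec, coeffMatrix_kronecker_mulVec, coeffMatrix_maxEntangled] at h
  simpa using h.symm

lemma M_eq : R.M = R.JB * coeffMatrix (V *ᵥ ξ) * R.JEᵀ := by
  have h := congrArg coeffMatrix R.M_spec
  rw [coeffMatrix_kronecker_mulVec, coeffMatrix_kronecker_mulVec, coeffMatrix_maxEntangled] at h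
  simpa using h.symm

end EntangledRep

/-- A vector supported on the tensor product of the initial spaces of two partial isometries has a
coefficient matrix that is fixed by the initial projectors on each side separately. -/
lemma eq_mul_of_partialIsometry {b e d : Type*} [Fintype b] [Fintype e] [Fintype d]
    {S : Matrix d b ℂ} {T : Matrix d e ℂ} (hS : S * Sᴴ * S = S) (hT : T * Tᴴ * T = T)
    {x : b × e → ℂ} (hx : ((Sᴴ * S) ⊗ₖ (Tᴴ * T)) *ᵥ x = x) :
    Sᴴ * (S * coeffMatrix x) = coeffMatrix x ∧ coeffMatrix x * Tᵀ * Tᵀᴴ = coeffMatrix x := by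
  have h := congrArg coeffMatrix hx
  rw [coeffMatrix_kronecker_mulVec, transpose_mul] at h
  have hT' : Tᵀ * Tᵀᴴ * Tᵀ = Tᵀ := by
    have := congrArg transpose hT
    rwa [transpose_mul, transpose_mul, ← Matrix.mul_assoc] at this
  constructor
  · conv_lhs => rw [← h]
    simp only [← Matrix.mul_assoc] at h ⊢
    rw [Matrix.mul_assoc Sᴴ S Sᴴ, Matrix.mul_assoc Sᴴ _ S, hS, h]
  · conv_lhs => rw [← h]
    change _ * (Tᵀ * Tᵀᴴ) * _ * _ = _
    change _ * (Tᵀ * Tᵀᴴ) = _ at h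
    rw [Matrix.mul_assoc _ (Tᵀ * Tᵀᴴ) Tᵀ, hT', Matrix.mul_assoc, h]

section Polar

variable {a b e d : Type*} [Fintype a] [Fintype b] [Fintype e] [Fintype d] [DecidableEq d]
  {V : Matrix (b × e) a ℂ} {ψ ξ : a → ℂ}

lemma isRankTangent_rep_iff {ρ : Matrix b b ℂ} (R : EntangledRep V ψ ξ ρ d) :
    IsRankTangent R.Λ R.M ↔
      IsRankTangent (coeffMatrix (V *ᵥ ψ)) (coeffMatrix (V *ᵥ ξ)) := by
  obtain ⟨hX, hX'⟩ :=
    eq_mul_of_partialIsometry R.JB_partialIsometry R.JE_partialIsometry R.support_ψ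
  obtain ⟨hY, hY'⟩ :=
    eq_mul_of_partialIsometry R.JB_partialIsometry R.JE_partialIsometry R.support_ξ
  rw [R.Λ_eq, R.M_eq]
  set X := coeffMatrix (V *ᵥ ψ)
  set Y := coeffMatrix (V *ᵥ ξ)
  have hX2 : R.JBᴴ * (R.JB * X * R.JEᵀ) * R.JEᵀᴴ = X := by
    rw [Matrix.mul_assoc R.JB, ← Matrix.mul_assoc, ← Matrix.mul_assoc,
      Matrix.mul_assoc R.JBᴴ, hX, hX']
  have hY2 : R.JBᴴ * (R.JB * Y * R.JEᵀ) * R.JEᵀᴴ = Y := by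
    rw [Matrix.mul_assoc R.JB, ← Matrix.mul_assoc, ← Matrix.mul_assoc,
      Matrix.mul_assoc R.JBᴴ, hY, hY']
  constructor
  · intro h
    refine h.of_compression R.JB R.JEᵀᴴ hY2.symm (fun u hu => ?_) fun v hv => ?_
    · have h2 : (R.JB * X * R.JEᵀ)ᴴ * R.JB = R.JEᵀᴴ * Xᴴ := by
        conv_rhs => rw [← hX]
        simp only [conjTranspose_mul, conjTranspose_conjTranspose, Matrix.mul_assoc]
      rw [mulVec_mulVec, h2, ← mulVec_mulVec, hu, mulVec_zero]
    · rw [mulVec_mulVec, Matrix.mul_assoc R.JB, Matrix.mul_assoc R.JB, hX', ← mulVec_mulVec, hv,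
        mulVec_zero]
  · intro h
    refine h.of_compression R.JBᴴ R.JEᵀ (by rw [conjTranspose_conjTranspose]) (fun u hu => ?_)
      fun v hv => ?_
    · have h2 : Xᴴ * R.JBᴴ = R.JEᵀ * (R.JB * X * R.JEᵀ)ᴴ := by
        conv_lhs => rw [← hX']
        simp only [conjTranspose_mul, conjTranspose_conjTranspose, Matrix.mul_assoc]
      rw [mulVec_mulVec, h2, ← mulVec_mulVec, hu, mulVec_zero]
    · have h2 : X * R.JEᵀ = R.JBᴴ * (R.JB * X * R.JEᵀ) := by
        conv_lhs => rw [← hX]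
        simp only [Matrix.mul_assoc]
      rw [mulVec_mulVec, h2, ← mulVec_mulVec, hv, mulVec_zero]

lemma polarCondition_iff {ρ : Matrix b b ℂ}
    (hρ : ρ = coeffMatrix (V *ᵥ ψ) * (coeffMatrix (V *ᵥ ψ))ᴴ) (R : EntangledRep V ψ ξ ρ d) :
    PolarCondition R ↔ IsRankTangent (coeffMatrix (V *ᵥ ψ)) (coeffMatrix (V *ᵥ ξ)) := by
  subst hρ
  obtain ⟨-, hX'⟩ :=
    eq_mul_of_partialIsometry R.JB_partialIsometry R.JE_partialIsometry R.support_ψ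
  have hρ : R.JB * (coeffMatrix (V *ᵥ ψ) * (coeffMatrix (V *ᵥ ψ))ᴴ) * R.JBᴴ = R.Λ * R.Λᴴ := by
    have h : R.JB * coeffMatrix (V *ᵥ ψ) * R.JEᵀ * R.JEᵀᴴ = R.JB * coeffMatrix (V *ᵥ ψ) := by
      rw [Matrix.mul_assoc R.JB, Matrix.mul_assoc R.JB, hX']
    rw [R.Λ_eq, conjTranspose_mul, ← Matrix.mul_assoc (_ * _ * R.JEᵀ), h, conjTranspose_mul]
    simp only [Matrix.mul_assoc]
  have hW : R.W * R.Wᴴ = 1 := mem_unitaryGroup_iff.mp R.W_unitary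
  have hW' : R.Wᴴ * R.W = 1 := mem_unitaryGroup_iff'.mp R.W_unitary
  -- By the polar decomposition, `W†` carries the kernel of `ρ` onto the kernel of `Λ`.
  have hΛ : R.Λ * R.Wᴴ = R.W * R.Λᴴ := by
    rw [R.polar, conjTranspose_mul, psdSqrt, (cfc_isHermitian _ _).eq, Matrix.mul_assoc, hW,
      Matrix.mul_one, ← Matrix.mul_assoc R.W, hW, Matrix.one_mul]
  rw [← isRankTangent_rep_iff R, PolarCondition, hρ,
    isRankTangent_iff_mul_eq_zero (Q := R.Wᴴ * kerProj (R.Λ * R.Λᴴ)), ← Matrix.mul_assoc]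
  · rw [← Matrix.mul_assoc, hΛ, Matrix.mul_assoc, mul_kerProj_of_conjTranspose, Matrix.mul_zero]
  · intro v hv
    refine ⟨R.W *ᵥ v, ?_⟩
    rw [← mulVec_mulVec, kerProj_mulVec_of_conjTranspose, mulVec_mulVec, hW', one_mulVec]
    have h : R.Λᴴ * R.W = R.Wᴴ * R.Λ := by
      rw [← Matrix.one_mul (R.Λᴴ * R.W), ← hW', Matrix.mul_assoc, ← Matrix.mul_assoc R.W, ← hΛ,
        Matrix.mul_assoc R.Λ, hW', Matrix.mul_one]
    rw [mulVec_mulVec, h, ← mulVec_mulVec, hv, mulVec_zero]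

end Polar

/-! ### First-order perturbation of the kernel of an operator -/

section Perturbation

variable {E F : Type*} [NormedAddCommGroup E] [NormedSpace ℂ E] [FiniteDimensional ℂ E]
  [NormedAddCommGroup F] [NormedSpace ℂ F] [FiniteDimensional ℂ F]

lemma exists_generalizedInverse (T : E →L[ℂ] F) : ∃ G : F →L[ℂ] E, ∀ x, T (G (T x)) = T x := by
  obtain ⟨g, hg⟩ := T.toLinearMap.rangeRestrict.exists_rightInverse_of_surjective
    T.toLinearMap.range_rangeRestrict
  obtain ⟨G, hG⟩ := LinearMap.exists_extend g
  refine ⟨LinearMap.toContinuousLinearMap G, fun x => ?_⟩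
  have h1 : G (T x) = g (T.toLinearMap.rangeRestrict x) := by
    rw [← hG]; rfl
  have h2 := congrArg Subtype.val (LinearMap.congr_fun hg (T.toLinearMap.rangeRestrict x))
  simpa [h1] using h2

/-- `T t` is `o(t - t₀)` on subspaces whose dimension is at least that of the kernel of `T t₀`. The
subspace may depend on `t` and on the constant `ε`, in any way. -/
def KernelPersists (T : ℝ → E →L[ℂ] F) (t₀ : ℝ) : Prop :=
  ∀ ε > 0, ∀ᶠ t in 𝓝 t₀, ∃ S : Submodule ℂ E,
    Module.finrank ℂ (T t₀).ker ≤ Module.finrank ℂ S ∧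
      ∀ w ∈ S, ‖T t w‖ ≤ ε * |t - t₀| * ‖w‖

/-- If `T₁` maps the kernel of `T t₀` into the range of `T t₀`, then each kernel vector `u` can be
corrected to first order to `u - (t - t₀) G T₁ u`, where `G` is a generalized inverse of `T t₀`. -/
lemma kernelPersists_of_forall_mem_range {T : ℝ → E →L[ℂ] F} {T₁ : E →L[ℂ] F} {t₀ : ℝ}
    (hT : HasDerivAt T T₁ t₀) (h : ∀ u, T t₀ u = 0 → ∃ w, T t₀ w = T₁ u) :
    KernelPersists T t₀ := by
  intro ε hε
  obtain ⟨G, hG⟩ := exists_generalizedInverse (T t₀)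
  set B : E →L[ℂ] E := G ∘L T₁ with hB
  have h1 : ∀ᶠ t in 𝓝 t₀, |t - t₀| * ‖B‖ < 1 / 2 := by
    have : Tendsto (fun t : ℝ => |t - t₀| * ‖B‖) (𝓝 t₀) (𝓝 (|t₀ - t₀| * ‖B‖)) :=
      Continuous.tendsto (by fun_prop) _
    rw [sub_self, abs_zero, zero_mul] at this
    exact this.eventually_lt_const (by norm_num)
  have h2 : ∀ᶠ t in 𝓝 t₀, |t - t₀| * (2 * ‖T₁ ∘L B‖) < ε / 2 := by
    have : Tendsto (fun t : ℝ => |t - t₀| * (2 * ‖T₁ ∘L B‖)) (𝓝 t₀)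
        (𝓝 (|t₀ - t₀| * (2 * ‖T₁ ∘L B‖))) :=
      Continuous.tendsto (by fun_prop) _
    rw [sub_self, abs_zero, zero_mul] at this
    exact this.eventually_lt_const (by positivity)
  filter_upwards [h1, h2, (hasDerivAt_iff_isLittleO.mp hT).def (half_pos hε)] with t h1 h2 h3
  set s : ℝ := t - t₀ with hs
  set C : (T t₀).ker →ₗ[ℂ] E :=
    (T t₀).ker.subtype - (s : ℂ) • (B.toLinearMap ∘ₗ (T t₀).ker.subtype) with hC
  have hCapply : ∀ u : (T t₀).ker, C u = (u : E) - (s : ℂ) • B u := fun u => rfl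
  have hbound : ∀ u : (T t₀).ker, ‖(u : E)‖ ≤ 2 * ‖C u‖ := by
    intro u
    have e1 : ‖(s : ℂ) • B u‖ ≤ |s| * ‖B‖ * ‖(u : E)‖ := by
      rw [norm_smul, Complex.norm_real, Real.norm_eq_abs, mul_assoc]
      gcongr
      exact B.le_opNorm _
    have e2 : ‖(u : E)‖ ≤ ‖C u‖ + ‖(s : ℂ) • B u‖ := by
      have := norm_add_le (C u) ((s : ℂ) • B u)
      rwa [hCapply, sub_add_cancel] at this
    nlinarith [norm_nonneg (u : E)]
  have hinj : Function.Injective C := by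
    rw [← LinearMap.ker_eq_bot, LinearMap.ker_eq_bot']
    intro u hu
    have := hbound u
    rw [hu, norm_zero, mul_zero] at this
    exact Subtype.ext (norm_le_zero_iff.mp this)
  refine ⟨LinearMap.range C, (LinearMap.finrank_range_of_inj hinj).ge, ?_⟩
  rintro _ ⟨u, rfl⟩
  have hu : T t₀ u = 0 := u.2
  have hTB : T t₀ (B u) = T₁ u := by
    obtain ⟨w, hw⟩ := h u hu
    rw [hB, ContinuousLinearMap.comp_apply, ← hw, hG]
  have e3 : T t (C u) = (T t - T t₀ - s • T₁) (C u) - (s : ℂ) • (s : ℂ) • T₁ (B u) := by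
    simp only [_root_.sub_apply, _root_.smul_apply]
    rw [← Complex.coe_smul s, hCapply]
    simp only [map_sub, map_smul, hu, hTB, smul_sub]
    abel
  have e4 : ‖(s : ℂ) • (s : ℂ) • T₁ (B u)‖ ≤ |s| * (|s| * (‖T₁ ∘L B‖ * ‖(u : E)‖)) := by
    rw [norm_smul, norm_smul, Complex.norm_real, Real.norm_eq_abs]
    gcongr
    exact (T₁ ∘L B).le_opNorm u
  have e5 : ‖(T t - T t₀ - s • T₁) (C u)‖ ≤ ε / 2 * |s| * ‖C u‖ :=
    (ContinuousLinearMap.le_opNorm _ _).trans (by gcongr; exact h3)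
  have e6 : |s| * (|s| * (‖T₁ ∘L B‖ * ‖(u : E)‖)) ≤ |s| * (ε / 2 * ‖C u‖) := by
    refine mul_le_mul_of_nonneg_left ?_ (abs_nonneg s)
    calc |s| * (‖T₁ ∘L B‖ * ‖(u : E)‖) ≤ |s| * (‖T₁ ∘L B‖ * (2 * ‖C u‖)) := by
          gcongr; exact hbound u
      _ = |s| * (2 * ‖T₁ ∘L B‖) * ‖C u‖ := by ring
      _ ≤ ε / 2 * ‖C u‖ := by gcongr
  rw [e3]
  refine (norm_sub_le _ _).trans ?_
  linarith

/-- If `T t` is small on a subspace `S` with the dimension of the kernel of `T t₀`, then the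
projection `1 - G T(t₀)` maps `S` onto this kernel, so that each kernel vector `u` is
approximated by vectors `w` of `S`. Modulo the range of `T t₀`, the vector `T₁ w` is the
difference quotient of `T t w`, and hence small. -/
lemma forall_mem_range_of_kernelPersists {T : ℝ → E →L[ℂ] F} {T₁ : E →L[ℂ] F} {t₀ : ℝ}
    (hT : HasDerivAt T T₁ t₀) (h : KernelPersists T t₀) (u : E) (hu : T t₀ u = 0) :
    ∃ w, T t₀ w = T₁ u := by
  obtain ⟨G, hG⟩ := exists_generalizedInverse (T t₀)
  set J : F →L[ℂ] F := ContinuousLinearMap.id ℂ F - T t₀ ∘L G with hJ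
  have hJT : ∀ x, J (T t₀ x) = 0 := fun x => by simp [hJ, hG]
  suffices hsuff : J (T₁ u) = 0 by
    refine ⟨G (T₁ u), ?_⟩
    exact (sub_eq_zero.mp hsuff).symm
  set Cst : ℝ := ‖J‖ * 4 * ‖u‖ + ‖J‖ * ‖T₁‖ * (2 * ‖u‖) with hCst
  have hCst0 : 0 ≤ Cst := by positivity
  suffices key : ∀ ε > 0, ε ≤ 1 → ‖J (T₁ u)‖ ≤ ε * Cst by
    by_contra hne
    have hpos : 0 < ‖J (T₁ u)‖ := norm_pos_iff.mpr hne
    have := key (min 1 (‖J (T₁ u)‖ / (2 * (Cst + 1)))) (by positivity) (min_le_left _ _)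
    have h2 : min 1 (‖J (T₁ u)‖ / (2 * (Cst + 1))) * Cst ≤
        ‖J (T₁ u)‖ / (2 * (Cst + 1)) * (Cst + 1) := by
      gcongr
      · exact min_le_right _ _
      · linarith
    have h3 : ‖J (T₁ u)‖ / (2 * (Cst + 1)) * (Cst + 1) = ‖J (T₁ u)‖ / 2 := by
      field_simp
    linarith
  intro ε hε hε1
  set D : ℝ := ‖G‖ * (2 + ‖T₁‖) with hD
  have hsmall : ∀ᶠ t in 𝓝 t₀, |t - t₀| * D < ε / 2 := by
    have : Tendsto (fun t : ℝ => |t - t₀| * D) (𝓝 t₀) (𝓝 (|t₀ - t₀| * D)) :=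
      Continuous.tendsto (by fun_prop) _
    rw [sub_self, abs_zero, zero_mul] at this
    exact this.eventually_lt_const (by positivity)
  have hev := ((h ε hε).and (((hasDerivAt_iff_isLittleO.mp hT).def hε).and hsmall))
  have hev' : ∀ᶠ t in 𝓝[≠] t₀, t ≠ t₀ := self_mem_nhdsWithin
  obtain ⟨t, ⟨⟨S, hdim, hS⟩, h3, h4⟩, hne⟩ :=
    ((hev.filter_mono nhdsWithin_le_nhds).and hev').exists
  set s : ℝ := t - t₀ with hs
  have hs0 : 0 < |s| := abs_pos.mpr (sub_ne_zero.mpr hne)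
  set R : E →L[ℂ] F := T t - T t₀ - s • T₁ with hR
  have hTw : ∀ w, T t w = T t₀ w + (s : ℂ) • T₁ w + R w := by
    intro w
    simp only [hR, _root_.sub_apply, _root_.smul_apply,
      ← Complex.coe_smul s]
    abel
  have hRw : ∀ w, ‖R w‖ ≤ ε * |s| * ‖w‖ := fun w =>
    (R.le_opNorm w).trans (by gcongr; exact h3)
  have hGT : ∀ w ∈ S, ‖G (T t₀ w)‖ ≤ ε / 2 * ‖w‖ := by
    intro w hw
    have e1 : T t₀ w = T t w - (s : ℂ) • T₁ w - R w := by rw [hTw]; abel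
    have e2 : ‖T t₀ w‖ ≤ |s| * (2 + ‖T₁‖) * ‖w‖ := by
      have e3 : ‖(s : ℂ) • T₁ w‖ ≤ |s| * (‖T₁‖ * ‖w‖) := by
        rw [norm_smul, Complex.norm_real, Real.norm_eq_abs]
        gcongr
        exact T₁.le_opNorm w
      rw [e1]
      have e4 := norm_sub_le (T t w - (s : ℂ) • T₁ w) (R w)
      have e5 := norm_sub_le (T t w) ((s : ℂ) • T₁ w)
      have e6 := hS w hw
      have e7 := hRw w
      have e8 : ε * |s| * ‖w‖ ≤ 1 * |s| * ‖w‖ := by gcongr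
      linarith
    calc ‖G (T t₀ w)‖ ≤ ‖G‖ * (|s| * (2 + ‖T₁‖) * ‖w‖) :=
          (G.le_opNorm _).trans (by gcongr)
      _ = |s| * D * ‖w‖ := by rw [hD]; ring
      _ ≤ ε / 2 * ‖w‖ := by gcongr
  -- The projection of `S` to the kernel of `T t₀` is injective, hence onto.
  let π : S →ₗ[ℂ] (T t₀).ker :=
    LinearMap.codRestrict _ ((ContinuousLinearMap.id ℂ E - G ∘L T t₀).toLinearMap ∘ₗ S.subtype)
      (fun w => by simp [hG])
  have hπ : ∀ w : S, ((π w : (T t₀).ker) : E) = w - G (T t₀ w) := fun w => rfl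
  have hinj : Function.Injective π := by
    rw [← LinearMap.ker_eq_bot, LinearMap.ker_eq_bot']
    intro w hw
    have e1 : (w : E) = G (T t₀ w) := by
      rw [← sub_eq_zero, ← hπ, hw]; rfl
    have e2 := hGT w w.2
    rw [← e1] at e2
    have e3 : ‖(w : E)‖ ≤ 0 := by nlinarith [norm_nonneg (w : E)]
    exact Subtype.ext (norm_le_zero_iff.mp e3)
  have hsurj : Function.Surjective π :=
    (LinearMap.injective_iff_surjective_of_finrank_eq_finrank
      (le_antisymm (LinearMap.finrank_le_finrank_of_injective hinj) hdim)).mp hinj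
  obtain ⟨w, hw⟩ := hsurj ⟨u, hu⟩
  have hwu : (w : E) - G (T t₀ w) = u := by rw [← hπ, hw]
  have hdiff : ‖(u - w : E)‖ ≤ ε / 2 * ‖(w : E)‖ := by
    rw [← hwu, sub_sub_cancel_left, norm_neg]
    exact hGT w w.2
  have hw2 : ‖(w : E)‖ ≤ 2 * ‖u‖ := by
    have e1 : ‖(w : E)‖ ≤ ‖u‖ + ‖(u - w : E)‖ := by
      have := norm_sub_le u (u - w : E)
      rwa [sub_sub_cancel] at this
    nlinarith [norm_nonneg (w : E)]
  have hJw : ‖J (T₁ w)‖ ≤ ‖J‖ * (2 * ε * ‖(w : E)‖) := by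
    have e1 : (s : ℂ) • J (T₁ w) = J (T t w - R w) := by
      rw [hTw, add_sub_cancel_right, map_add, hJT, zero_add, map_smul]
    have e2 : |s| * ‖J (T₁ w)‖ ≤ |s| * (‖J‖ * (2 * ε * ‖(w : E)‖)) := by
      calc |s| * ‖J (T₁ w)‖ = ‖J (T t w - R w)‖ := by
            rw [← e1, norm_smul, Complex.norm_real, Real.norm_eq_abs]
        _ ≤ ‖J‖ * (ε * |s| * ‖(w : E)‖ + ε * |s| * ‖(w : E)‖) := by
            refine (J.le_opNorm _).trans ?_
            gcongr
            exact (norm_sub_le _ _).trans (add_le_add (hS w w.2) (hRw w))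
        _ = _ := by ring
    exact le_of_mul_le_mul_left e2 hs0
  have hsplit : J (T₁ u) = J (T₁ w) + J (T₁ (u - w)) := by
    rw [← map_add, ← map_add, add_sub_cancel]
  calc ‖J (T₁ u)‖ ≤ ‖J (T₁ w)‖ + ‖J (T₁ (u - w))‖ := by rw [hsplit]; exact norm_add_le _ _
    _ ≤ ‖J‖ * (2 * ε * (2 * ‖u‖)) + ‖J‖ * (‖T₁‖ * (ε * (2 * ‖u‖))) := by
        refine add_le_add (hJw.trans (by gcongr)) ?_
        refine (J.le_opNorm _).trans ?_
        gcongr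
        refine (T₁.le_opNorm _).trans ?_
        gcongr
        refine hdiff.trans ?_
        gcongr
        linarith
    _ = ε * Cst := by rw [hCst]; ring

theorem kernelPersists_iff {T : ℝ → E →L[ℂ] F} {T₁ : E →L[ℂ] F} {t₀ : ℝ}
    (hT : HasDerivAt T T₁ t₀) :
    KernelPersists T t₀ ↔ ∀ u, T t₀ u = 0 → ∃ w, T t₀ w = T₁ u :=
  ⟨forall_mem_range_of_kernelPersists hT, kernelPersists_of_forall_mem_range hT⟩

omit [FiniteDimensional ℂ E] [FiniteDimensional ℂ F] in
lemma KernelPersists.of_norm_le {T T' : ℝ → E →L[ℂ] F} {t₀ : ℝ} (h : KernelPersists T t₀)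
    (h₀ : T' t₀ = T t₀) {C : ℝ} (hC : 0 < C)
    (hle : ∀ᶠ t in 𝓝 t₀, ∀ w, ‖T' t w‖ ≤ C * ‖T t w‖) : KernelPersists T' t₀ := by
  intro ε hε
  filter_upwards [h (ε / C) (by positivity), hle] with t ⟨S, hdim, hS⟩ ht
  refine ⟨S, by rwa [h₀], fun w hw => ?_⟩
  calc ‖T' t w‖ ≤ C * (ε / C * |t - t₀| * ‖w‖) := (ht w).trans (by gcongr; exact hS w hw)
    _ = ε * |t - t₀| * ‖w‖ := by field_simp

end Perturbation

/-! ### Counting small eigenvalues -/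

section Counting

variable {m n : Type*} [Fintype m] [Fintype n] [DecidableEq m]

/-- The operator of the matrix `X†` between Euclidean spaces. -/
noncomputable def adjointOp (X : Matrix m n ℂ) : EuclideanSpace ℂ m →L[ℂ] EuclideanSpace ℂ n :=
  LinearMap.toContinuousLinearMap (toEuclideanLin Xᴴ)

lemma adjointOp_apply (X : Matrix m n ℂ) (w : EuclideanSpace ℂ m) :
    adjointOp X w = WithLp.toLp 2 (Xᴴ *ᵥ w.ofLp) := rfl

lemma norm_adjointOp_sq (X : Matrix m n ℂ) (w : EuclideanSpace ℂ m) :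
    ‖adjointOp X w‖ ^ 2 = ∑ k, (isHermitian_mul_conjTranspose_self X).eigenvalues k *
      ‖inner ℂ ((isHermitian_mul_conjTranspose_self X).eigenvectorBasis k) w‖ ^ 2 := by
  set hρ := isHermitian_mul_conjTranspose_self X
  set v := hρ.eigenvectorBasis
  have h1 : (inner ℂ (adjointOp X w) (adjointOp X w) : ℂ) =
      inner ℂ w (WithLp.toLp 2 ((X * Xᴴ) *ᵥ w.ofLp) : EuclideanSpace ℂ m) := by
    simp only [adjointOp_apply, EuclideanSpace.inner_eq_star_dotProduct]
    rw [dotProduct_comm, star_mulVec_dotProduct, conjTranspose_conjTranspose, mulVec_mulVec,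
      dotProduct_comm]
  have h2 : ∀ k, (inner ℂ (v k) (WithLp.toLp 2 ((X * Xᴴ) *ᵥ w.ofLp) : EuclideanSpace ℂ m) : ℂ) =
      hρ.eigenvalues k * inner ℂ (v k) w := by
    intro k
    simp only [EuclideanSpace.inner_eq_star_dotProduct]
    have h : star (v k).ofLp ⬝ᵥ ((X * Xᴴ) *ᵥ w.ofLp) =
        star ((X * Xᴴ) *ᵥ (v k).ofLp) ⬝ᵥ w.ofLp := by
      rw [star_mulVec_dotProduct, hρ.eq]
    rw [dotProduct_comm, h, hρ.mulVec_eigenvectorBasis, star_smul, smul_dotProduct,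
      dotProduct_comm, star_trivial, Complex.real_smul]
  have h3 : ((‖adjointOp X w‖ ^ 2 : ℝ) : ℂ) =
      ((∑ k, hρ.eigenvalues k * ‖inner ℂ (v k) w‖ ^ 2 : ℝ) : ℂ) := by
    push_cast
    refine (inner_self_eq_norm_sq_to_K (𝕜 := ℂ) (adjointOp X w)).symm.trans ?_
    rw [h1, ← v.sum_inner_mul_inner]
    refine Finset.sum_congr rfl fun k _ => ?_
    rw [h2, mul_left_comm, ← inner_conj_symm, Complex.conj_mul']
  exact_mod_cast h3

lemma map_eq_map_eigenvalues_of_charpoly_eq {ι : Type*} [Fintype ι] {A : Matrix m m ℂ}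
    (hA : A.IsHermitian) {p : ι → ℝ}
    (hp : A.charpoly = ∏ k, (Polynomial.X - Polynomial.C ((p k : ℝ) : ℂ))) :
    (Finset.univ.val.map p) = Finset.univ.val.map hA.eigenvalues := by
  have h1 := hA.roots_charpoly_eq_eigenvalues
  rw [hp, Polynomial.roots_prod _ _ (Finset.prod_ne_zero_iff.mpr fun k _ =>
    Polynomial.X_sub_C_ne_zero _)] at h1
  simp only [Polynomial.roots_X_sub_C, Multiset.bind_singleton] at h1
  rw [← Function.comp_def, ← Multiset.map_map, ← Multiset.map_map] at h1
  exact Multiset.map_injective Complex.ofReal_injective h1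

variable {X : Matrix m n ℂ} {ι : Type*} [Fintype ι] {p : ι → ℝ}

lemma nonneg_of_charpoly_eq
    (hp : (X * Xᴴ).charpoly = ∏ k, (Polynomial.X - Polynomial.C ((p k : ℝ) : ℂ))) (k : ι) :
    0 ≤ p k := by
  have hk : p k ∈ Finset.univ.val.map p := Multiset.mem_map_of_mem _ (Finset.mem_univ k)
  rw [map_eq_map_eigenvalues_of_charpoly_eq (isHermitian_mul_conjTranspose_self X) hp] at hk
  obtain ⟨j, -, hj⟩ := Multiset.mem_map.mp hk
  rw [← hj]
  exact (posSemidef_self_mul_conjTranspose X).eigenvalues_nonneg j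

lemma card_filter_le_of_charpoly_eq
    (hp : (X * Xᴴ).charpoly = ∏ k, (Polynomial.X - Polynomial.C ((p k : ℝ) : ℂ))) (c : ℝ) :
    (Finset.univ.filter fun k => p k ≤ c).card =
      (Finset.univ.filter fun k =>
        (isHermitian_mul_conjTranspose_self X).eigenvalues k ≤ c).card := by
  have h := congrArg (fun s => (Multiset.filter (· ≤ c) s).card)
    (map_eq_map_eigenvalues_of_charpoly_eq (isHermitian_mul_conjTranspose_self X) hp)
  simp only [Multiset.filter_map, Multiset.card_map] at h
  exact h

/-- The easy half of the Courant–Fischer principle: on a subspace on which `w ↦ ‖X† w‖²` is at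
most `c ‖w‖²`, the components along the eigenvectors with eigenvalues at most `c` determine `w`. -/
lemma finrank_le_card_filter
    (hp : (X * Xᴴ).charpoly = ∏ k, (Polynomial.X - Polynomial.C ((p k : ℝ) : ℂ))) {c : ℝ}
    {S : Submodule ℂ (EuclideanSpace ℂ m)} (hS : ∀ w ∈ S, ‖adjointOp X w‖ ^ 2 ≤ c * ‖w‖ ^ 2) :
    Module.finrank ℂ S ≤ (Finset.univ.filter fun k => p k ≤ c).card := by
  rw [card_filter_le_of_charpoly_eq hp]
  set hρ := isHermitian_mul_conjTranspose_self X
  set v := hρ.eigenvectorBasis with hv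
  let f : S →ₗ[ℂ] ({k // hρ.eigenvalues k ≤ c} → ℂ) :=
    LinearMap.pi fun k => (innerSL ℂ (v k)).toLinearMap ∘ₗ S.subtype
  have hf : ∀ (w : S) k, f w k = inner ℂ (v k) (w : EuclideanSpace ℂ m) := fun _ _ => rfl
  have hinj : Function.Injective f := by
    rw [← LinearMap.ker_eq_bot, LinearMap.ker_eq_bot']
    intro w hw
    have h0 : ∀ k, hρ.eigenvalues k ≤ c → inner ℂ (v k) (w : EuclideanSpace ℂ m) = 0 := by
      intro k hk
      rw [← hf w ⟨k, hk⟩, hw]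
      rfl
    have h1 := hS w w.2
    rw [norm_adjointOp_sq, ← v.sum_sq_norm_inner_right, Finset.mul_sum, ← sub_nonpos,
      ← Finset.sum_sub_distrib] at h1
    have h2 : ∀ k ∈ Finset.univ,
        0 ≤ hρ.eigenvalues k * ‖inner ℂ (v k) (w : EuclideanSpace ℂ m)‖ ^ 2 -
          c * ‖inner ℂ (v k) (w : EuclideanSpace ℂ m)‖ ^ 2 := by
      intro k _
      rw [← sub_mul]
      rcases le_or_gt (hρ.eigenvalues k) c with hk | hk
      · simp [h0 k hk]
      · exact mul_nonneg (sub_nonneg.mpr hk.le) (sq_nonneg _)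
    have h3 := (Finset.sum_eq_zero_iff_of_nonneg h2).mp (le_antisymm h1 (Finset.sum_nonneg h2))
    refine Subtype.ext (v.repr.injective (PiLp.ext fun k => ?_))
    rw [v.repr_apply_apply, v.repr_apply_apply, ZeroMemClass.coe_zero, inner_zero_right]
    rcases le_or_gt (hρ.eigenvalues k) c with hk | hk
    · exact h0 k hk
    · have h4 := h3 k (Finset.mem_univ k)
      rw [← sub_mul, mul_eq_zero, or_iff_right (sub_pos.mpr hk).ne'] at h4
      exact norm_eq_zero.mp (pow_eq_zero_iff two_ne_zero |>.mp h4)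
  have := LinearMap.finrank_le_finrank_of_injective hinj
  rwa [Module.finrank_fintype_fun_eq_card, Fintype.card_subtype] at this

lemma exists_finrank_eq_card_filter
    (hp : (X * Xᴴ).charpoly = ∏ k, (Polynomial.X - Polynomial.C ((p k : ℝ) : ℂ))) (c : ℝ) :
    ∃ S : Submodule ℂ (EuclideanSpace ℂ m),
      Module.finrank ℂ S = (Finset.univ.filter fun k => p k ≤ c).card ∧
        ∀ w ∈ S, ‖adjointOp X w‖ ^ 2 ≤ c * ‖w‖ ^ 2 := by
  rw [card_filter_le_of_charpoly_eq hp]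
  set hρ := isHermitian_mul_conjTranspose_self X
  set v := hρ.eigenvectorBasis with hv
  let u : {k // hρ.eigenvalues k ≤ c} → EuclideanSpace ℂ m := fun k => v k
  have hu : LinearIndependent ℂ u :=
    v.orthonormal.linearIndependent.comp _ Subtype.val_injective
  refine ⟨Submodule.span ℂ (Set.range u), ?_, fun w hw => ?_⟩
  · rw [finrank_span_eq_card hu, Fintype.card_subtype]
  · have h0 : ∀ k, c < hρ.eigenvalues k → inner ℂ (v k) w = 0 := by
      intro k hk
      have hle : Submodule.span ℂ (Set.range u) ≤ (innerSL ℂ (v k)).toLinearMap.ker := by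
        rw [Submodule.span_le]
        rintro _ ⟨j, rfl⟩
        have hne : k ≠ j := fun h => absurd j.2 (not_le.mpr (h ▸ hk))
        exact v.orthonormal.2 hne
      exact hle hw
    rw [norm_adjointOp_sq, ← v.sum_sq_norm_inner_right, Finset.mul_sum]
    refine Finset.sum_le_sum fun k _ => ?_
    rcases le_or_gt (hρ.eigenvalues k) c with hk | hk
    · exact mul_le_mul_of_nonneg_right hk (sq_nonneg _)
    · simp [← hv, h0 k hk]

lemma finrank_ker_adjointOp
    (hp : (X * Xᴴ).charpoly = ∏ k, (Polynomial.X - Polynomial.C ((p k : ℝ) : ℂ))) :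
    Module.finrank ℂ (adjointOp X).ker = (Finset.univ.filter fun k => p k = 0).card := by
  have h0 : (Finset.univ.filter fun k => p k = 0) = Finset.univ.filter fun k => p k ≤ 0 :=
    Finset.filter_congr fun k _ => (nonneg_of_charpoly_eq hp k).ge_iff_eq'.symm
  rw [h0]
  refine le_antisymm (finrank_le_card_filter hp fun w hw => ?_) ?_
  · rw [show adjointOp X w = 0 from hw]
    simp
  · obtain ⟨S, hS, hSw⟩ := exists_finrank_eq_card_filter hp 0
    rw [← hS]
    refine Submodule.finrank_mono fun w hw => ?_
    have h := hSw w hw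
    rw [zero_mul] at h
    exact norm_eq_zero.mp (pow_eq_zero_iff two_ne_zero |>.mp (le_antisymm h (sq_nonneg _)))

/-- The kernel of `X†` persists to first order exactly if the eigenvalues of `X X†` that vanish at
`t₀` are `o((t - t₀)²)`. The eigenvalues may be listed in any way that keeps the order which they
have at `t₀`. -/
theorem kernelPersists_iff_eigenvalues {X : ℝ → Matrix m n ℂ} {t₀ : ℝ} {p : ι → ℝ → ℝ}
    (hp : ∀ᶠ t in 𝓝 t₀, (X t * (X t)ᴴ).charpoly =
      ∏ k, (Polynomial.X - Polynomial.C ((p k t : ℝ) : ℂ)))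
    (hord : ∀ᶠ t in 𝓝 t₀, ∀ k l, p k t₀ < p l t₀ → p k t ≤ p l t) :
    KernelPersists (fun t => adjointOp (X t)) t₀ ↔
      ∀ k, p k t₀ = 0 → ∀ ε > 0, ∀ᶠ t in 𝓝 t₀, p k t ≤ ε * (t - t₀) ^ 2 := by
  have hp₀ := hp.self_of_nhds
  have hiff : ∀ {ε : ℝ}, 0 < ε → ∀ t (S : Submodule ℂ (EuclideanSpace ℂ m)),
      (∀ w ∈ S, ‖adjointOp (X t) w‖ ≤ ε * |t - t₀| * ‖w‖) ↔
        ∀ w ∈ S, ‖adjointOp (X t) w‖ ^ 2 ≤ ε ^ 2 * (t - t₀) ^ 2 * ‖w‖ ^ 2 := by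
    intro ε hε t S
    refine forall₂_congr fun w _ => ?_
    rw [← sq_abs (t - t₀), ← mul_pow, ← mul_pow, pow_le_pow_iff_left₀ (norm_nonneg _)
      (by positivity) two_ne_zero]
  constructor
  · intro h k hk ε hε
    filter_upwards [h (√ε) (Real.sqrt_pos.mpr hε), hp, hord] with t ⟨S, hdim, hS⟩ hpt hot
    rw [hiff (Real.sqrt_pos.mpr hε), Real.sq_sqrt hε.le] at hS
    have h1 := hdim.trans (finrank_le_card_filter hpt hS)
    rw [finrank_ker_adjointOp hp₀] at h1
    by_contra! hlt
    -- Otherwise each eigenvalue below the bound is one that vanishes at `t₀`, but is not `p k`.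
    refine absurd h1 (not_le.mpr (Finset.card_lt_card ?_))
    refine Finset.ssubset_iff_of_subset (fun l hl => ?_) |>.mpr
      ⟨k, by simpa using hk, by simpa using hlt⟩
    rw [Finset.mem_filter] at hl ⊢
    refine ⟨hl.1, ?_⟩
    by_contra hne
    have hpos : p k t₀ < p l t₀ := by
      rw [hk]
      exact lt_of_le_of_ne (nonneg_of_charpoly_eq hp₀ l) (Ne.symm hne)
    exact absurd (hlt.trans_le (hot k l hpos)) (not_lt.mpr hl.2)
  · intro h ε hε
    have hev : ∀ᶠ t in 𝓝 t₀, ∀ k, p k t₀ = 0 → p k t ≤ ε ^ 2 * (t - t₀) ^ 2 := by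
      rw [eventually_all]
      intro k
      by_cases hk : p k t₀ = 0
      · filter_upwards [h k hk (ε ^ 2) (by positivity)] with t ht _ using ht
      · exact Eventually.of_forall fun t h0 => absurd h0 hk
    filter_upwards [hev, hp] with t ht hpt
    obtain ⟨S, hS, hSw⟩ := exists_finrank_eq_card_filter hpt (ε ^ 2 * (t - t₀) ^ 2)
    refine ⟨S, ?_, (hiff hε t S).mpr hSw⟩
    rw [hS, finrank_ker_adjointOp hp₀]
    refine Finset.card_le_card fun k hk => ?_
    rw [Finset.mem_filter] at hk ⊢
    exact ⟨hk.1, ht k hk.2⟩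

end Counting
/-! ### Second derivatives of nonnegative functions at a zero -/

section SecondDerivative

/-- The coefficient of first order in a second-order expansion is the derivative. -/
lemma hasDerivAt_of_isLittleO_sq {f : ℝ → ℝ} {c m t₀ : ℝ}
    (h : (fun t => f t - (f t₀ + c * (t - t₀) + m / 2 * (t - t₀) ^ 2))
      =o[𝓝 t₀] fun t => (t - t₀) ^ 2) : HasDerivAt f c t₀ := by
  rw [hasDerivAt_iff_isLittleO]
  have h1 : (fun t : ℝ => (t - t₀) ^ 2) =o[𝓝 t₀] fun t => t - t₀ :=
    (Asymptotics.isLittleO_pow_sub_sub t₀ one_lt_two).congr_left fun t => by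
      rw [Real.norm_eq_abs, sq_abs]
  refine ((h.trans h1).add (h1.const_mul_left (m / 2))).congr_left fun t => ?_
  simp only [smul_eq_mul]
  ring

lemma hasSecondDerivAt_zero_iff {f : ℝ → ℝ} {t₀ : ℝ} (h₀ : f t₀ = 0)
    (hf : ∀ᶠ t in 𝓝 t₀, 0 ≤ f t) :
    HasSecondDerivAt f 0 t₀ ↔ ∀ ε > 0, ∀ᶠ t in 𝓝 t₀, f t ≤ ε * (t - t₀) ^ 2 := by
  constructor
  · rintro ⟨c, hc⟩
    have hmin : IsLocalMin f t₀ := by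
      filter_upwards [hf] with t ht
      rwa [h₀]
    have hc0 : c = 0 := hmin.hasDerivAt_eq_zero (hasDerivAt_of_isLittleO_sq hc)
    intro ε hε
    filter_upwards [hc.def hε] with t ht
    rw [h₀, hc0] at ht
    simpa using (le_abs_self _).trans ht
  · intro h
    refine ⟨0, Asymptotics.isLittleO_iff.mpr fun ε hε => ?_⟩
    filter_upwards [h ε hε, hf] with t ht hft
    rw [h₀]
    simpa [abs_of_nonneg hft] using ht

/-- Taylor's theorem of second order with Peano's remainder. -/
lemma hasSecondDerivAt_deriv_deriv {f : ℝ → ℝ} {t₀ : ℝ} (hf : TwiceDifferentiableAt f t₀) :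
    HasSecondDerivAt f (deriv (deriv f) t₀) t₀ := by
  refine ⟨deriv f t₀, ?_⟩
  set m := deriv (deriv f) t₀ with hm
  rw [Asymptotics.isLittleO_iff]
  intro ε hε
  obtain ⟨hev, hd⟩ := hf
  obtain ⟨r, hr, hball⟩ := Metric.eventually_nhds_iff_ball.mp
    (hev.and ((hasDerivAt_iff_isLittleO.mp hd.hasDerivAt).def hε))
  filter_upwards [Metric.ball_mem_nhds t₀ hr] with t ht
  set g : ℝ → ℝ := fun x => f x - (f t₀ + deriv f t₀ * (x - t₀) + m / 2 * (x - t₀) ^ 2) with hg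
  have hseg : segment ℝ t₀ t ⊆ Metric.ball t₀ r :=
    (convex_ball t₀ r).segment_subset (Metric.mem_ball_self hr) ht
  have hgd : ∀ x ∈ segment ℝ t₀ t,
      HasDerivWithinAt g (deriv f x - deriv f t₀ - (x - t₀) * m) (segment ℝ t₀ t) x := by
    intro x hx
    have h1 := (hball x (hseg hx)).1.hasDerivAt
    have h2 := (hasDerivAt_id x).sub_const t₀
    have h3 := h1.sub (((h2.const_mul (deriv f t₀)).const_add (f t₀)).add
      ((h2.pow 2).const_mul (m / 2)))
    refine (h3.congr_deriv ?_).hasDerivWithinAt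
    simp
    ring
  have hb : ∀ x ∈ segment ℝ t₀ t, ‖deriv f x - deriv f t₀ - (x - t₀) * m‖ ≤ ε * |t - t₀| := by
    intro x hx
    refine (hball x (hseg hx)).2.trans ?_
    rw [segment_eq_uIcc] at hx
    gcongr
    exact Set.abs_sub_left_of_mem_uIcc hx
  have := (convex_segment t₀ t).norm_image_sub_le_of_norm_hasDerivWithin_le hgd hb
    (left_mem_segment ℝ t₀ t) (right_mem_segment ℝ t₀ t)
  have hg0 : g t₀ = 0 := by simp [hg]
  rw [hg0, sub_zero] at this
  refine this.trans (le_of_eq ?_)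
  rw [Real.norm_eq_abs, Real.norm_eq_abs, abs_pow]
  ring

lemma HasSecondDerivAt.unique {f : ℝ → ℝ} {m m' t₀ : ℝ} (h : HasSecondDerivAt f m t₀)
    (h' : HasSecondDerivAt f m' t₀) : m = m' := by
  obtain ⟨c, hc⟩ := h
  obtain ⟨c', hc'⟩ := h'
  obtain rfl := (hasDerivAt_of_isLittleO_sq hc).unique (hasDerivAt_of_isLittleO_sq hc')
  have h : (fun t : ℝ => (m' - m) / 2 * (t - t₀) ^ 2) =o[𝓝 t₀] fun t => (t - t₀) ^ 2 :=
    (hc.sub hc').congr_left fun t => by ring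
  by_contra hne
  rw [Asymptotics.isLittleO_const_mul_left_iff
    (div_ne_zero (sub_ne_zero.mpr (Ne.symm hne)) two_ne_zero)] at h
  have hev : ∀ᶠ t in 𝓝[≠] t₀, t ≠ t₀ := self_mem_nhdsWithin
  have hfr : ∃ᶠ t in 𝓝[≠] t₀, (t - t₀) ^ 2 ≠ 0 :=
    (hev.mono fun t ht => pow_ne_zero 2 (sub_ne_zero.mpr ht)).frequently
  exact Asymptotics.isLittleO_irrefl (hfr.filter_mono nhdsWithin_le_nhds) h

lemma deriv_deriv_eq_zero_iff {f : ℝ → ℝ} {t₀ : ℝ} (hd : TwiceDifferentiableAt f t₀)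
    (h₀ : f t₀ = 0) (hf : ∀ᶠ t in 𝓝 t₀, 0 ≤ f t) :
    deriv (deriv f) t₀ = 0 ↔ ∀ ε > 0, ∀ᶠ t in 𝓝 t₀, f t ≤ ε * (t - t₀) ^ 2 := by
  rw [← hasSecondDerivAt_zero_iff h₀ hf]
  have h := hasSecondDerivAt_deriv_deriv hd
  exact ⟨fun h0 => h0 ▸ h, fun h0 => h.unique h0⟩

end SecondDerivative

/-! ### Eigenvalues in decreasing order -/

section Spectra

variable {n : Type*} [Fintype n] [DecidableEq n]

lemma charpoly_eq_prod_sortedEigenvalue {A : Matrix n n ℂ} (hA : A.IsHermitian) :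
    A.charpoly = ∏ k, (Polynomial.X - Polynomial.C ((sortedEigenvalue A k : ℝ) : ℂ)) := by
  rw [hA.charpoly_eq]
  refine Fintype.prod_equiv (Fintype.equivOfCardEq (Fintype.card_fin _)).symm _ _ fun k => ?_
  rw [sortedEigenvalue, dif_pos hA]
  rfl

lemma sortedEigenvalue_antitone {A : Matrix n n ℂ} (hA : A.IsHermitian) :
    Antitone (sortedEigenvalue A) := by
  intro k l hkl
  rw [sortedEigenvalue, sortedEigenvalue, dif_pos hA, dif_pos hA]
  exact hA.eigenvalues₀_antitone hkl

end Spectra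

/-! ### The evolution of the coefficient matrix -/

section Evolution

lemma hasDerivAt_adjointOp {m n : Type*} [Fintype m] [Fintype n] [DecidableEq m]
    {X : ℝ → Matrix m n ℂ} {X₁ : Matrix m n ℂ} {t₀ : ℝ}
    (h : ∀ i k, HasDerivAt (fun t => X t i k) (X₁ i k) t₀) :
    HasDerivAt (fun t => adjointOp (X t)) (adjointOp X₁) t₀ := by
  classical
  have hsum : ∀ Y : Matrix m n ℂ,
      adjointOp Y = ∑ i, ∑ k, star (Y i k) • adjointOp (single i k (1 : ℂ)) := by
    intro Y
    have h1 : Yᴴ = ∑ i, ∑ k, star (Y i k) • (single i k (1 : ℂ))ᴴ := by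
      conv_lhs => rw [matrix_eq_sum_single Y]
      simp only [conjTranspose_sum, conjTranspose_single, smul_single, star_one, smul_eq_mul,
        mul_one]
    rw [adjointOp, h1]
    simp only [map_sum, map_smul, adjointOp]
  rw [hsum X₁, funext fun t => hsum (X t)]
  exact HasDerivAt.fun_sum fun i _ => HasDerivAt.fun_sum fun k _ => 
    (h i k).star.smul_const (adjointOp (single i k (1 : ℂ)))

variable {a b e : Type*} [Fintype a] [Fintype b] [Fintype e]

lemma ketbra_mulVec (φ ψ : a → ℂ) : ketbra φ φ *ᵥ ψ = (star φ ⬝ᵥ ψ) • φ := by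
  rw [ketbra, vecMulVec_mulVec, op_smul_eq_smul]

variable {H : Matrix a a ℂ} {φ : ℝ → a → ℂ} {t₀ : ℝ} {ψ ξ : a → ℂ}

lemma IsEvolution.hasDerivAt_ketbra_mulVec (hφ : IsEvolution H φ t₀ ψ)
    (hψ : star ψ ⬝ᵥ ψ = 1) (hξ : ξ = H *ᵥ ψ - expVal H ψ • ψ) (i : a) :
    HasDerivAt (fun t => (ketbra (φ t) (φ t) *ᵥ ψ) i) ((-Complex.I • ξ) i) t₀ := by
  have h1 : (-Complex.I • ξ) = (-Complex.I • (H * ketbra ψ ψ - ketbra ψ ψ * H)) *ᵥ ψ := by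
    rw [smul_mulVec, sub_mulVec, ← mulVec_mulVec, ← mulVec_mulVec, ketbra_mulVec, hψ, one_smul,
      ketbra, vecMulVec_mulVec, op_smul_eq_smul, hξ, expVal]
  rw [h1]
  exact HasDerivAt.fun_sum fun j _ => (hφ.schrodinger i j).mul_const (ψ j)

omit [Fintype b] [Fintype e] in
/-- Only the projector of `|φ(t)⟩` is known to be differentiable, and not its phase. The vectors
`|φ(t)⟩⟨φ(t)|ψ⟩` are images of `|ψ⟩` under the projector, and have the derivative `-i |ξ⟩`. -/
lemma IsEvolution.hasDerivAt_coeffMatrix (hφ : IsEvolution H φ t₀ ψ)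
    (hψ : star ψ ⬝ᵥ ψ = 1) (hξ : ξ = H *ᵥ ψ - expVal H ψ • ψ) (V : Matrix (b × e) a ℂ)
    (i : b) (k : e) :
    HasDerivAt (fun t => coeffMatrix (V *ᵥ (ketbra (φ t) (φ t) *ᵥ ψ)) i k)
      ((-Complex.I • coeffMatrix (V *ᵥ ξ)) i k) t₀ := by
  have h1 : -Complex.I • coeffMatrix (V *ᵥ ξ) = coeffMatrix (V *ᵥ (-Complex.I • ξ)) := by
    rw [mulVec_smul, coeffMatrix_smul]
  rw [h1]
  exact HasDerivAt.fun_sum fun j _ => (hφ.hasDerivAt_ketbra_mulVec hψ hξ j).const_mul (V (i, k) j)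

lemma IsEvolution.tendsto_overlap (hφ : IsEvolution H φ t₀ ψ) (hψ : star ψ ⬝ᵥ ψ = 1) :
    Tendsto (fun t => ‖star (φ t) ⬝ᵥ ψ‖ ^ 2) (𝓝 t₀) (𝓝 1) := by
  have h1 : ∀ t, ‖star (φ t) ⬝ᵥ ψ‖ ^ 2 = ‖star ψ ⬝ᵥ (ketbra (φ t) (φ t) *ᵥ ψ)‖ := by
    intro t
    have h2 : star ψ ⬝ᵥ φ t = star (star (φ t) ⬝ᵥ ψ) :=
      star_dotProduct _ _
    rw [ketbra_mulVec, dotProduct_smul, h2, smul_eq_mul, norm_mul, norm_star, sq]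
  have h2 : ContinuousAt (fun t => ‖star ψ ⬝ᵥ (ketbra (φ t) (φ t) *ᵥ ψ)‖) t₀ := by
    refine ContinuousAt.norm ?_
    simp only [dotProduct, mulVec]
    refine tendsto_finsetSum _ fun i _ => (tendsto_finsetSum _ fun j _ => ?_).const_mul _
    exact ((hφ.schrodinger i j).continuousAt.tendsto).mul_const _
  simp only [h1]
  have h3 : ‖star ψ ⬝ᵥ (ketbra (φ t₀) (φ t₀) *ᵥ ψ)‖ = 1 := by
    rw [hφ.initial, ketbra_mulVec, hψ, one_smul, hψ, norm_one]
  exact h3 ▸ h2.tendsto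

lemma adjointOp_smul [DecidableEq b] (c : ℂ) (X : Matrix b e ℂ) :
    adjointOp (c • X) = star c • adjointOp X := by
  rw [adjointOp, adjointOp, conjTranspose_smul, map_smul, map_smul]

/-- Replacing `|φ(t)⟩` by `|φ(t)⟩⟨φ(t)|ψ⟩` multiplies the operators by numbers whose modulus tends
to `1`. -/
lemma IsEvolution.kernelPersists_iff [DecidableEq b] (hφ : IsEvolution H φ t₀ ψ)
    (hψ : star ψ ⬝ᵥ ψ = 1) (V : Matrix (b × e) a ℂ) :
    KernelPersists (fun t => adjointOp (coeffMatrix (V *ᵥ (ketbra (φ t) (φ t) *ᵥ ψ)))) t₀ ↔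
      KernelPersists (fun t => adjointOp (coeffMatrix (V *ᵥ φ t))) t₀ := by
  have hop : ∀ t, adjointOp (coeffMatrix (V *ᵥ (ketbra (φ t) (φ t) *ᵥ ψ))) =
      star (star (φ t) ⬝ᵥ ψ) • adjointOp (coeffMatrix (V *ᵥ φ t)) := by
    intro t
    rw [ketbra_mulVec, mulVec_smul, coeffMatrix_smul, adjointOp_smul]
  have hnorm : ∀ t w, ‖adjointOp (coeffMatrix (V *ᵥ (ketbra (φ t) (φ t) *ᵥ ψ))) w‖ =
      ‖star (φ t) ⬝ᵥ ψ‖ * ‖adjointOp (coeffMatrix (V *ᵥ φ t)) w‖ := by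
    intro t w
    rw [hop, _root_.smul_apply, norm_smul, norm_star]
  have h₀ : adjointOp (coeffMatrix (V *ᵥ (ketbra (φ t₀) (φ t₀) *ᵥ ψ))) =
      adjointOp (coeffMatrix (V *ᵥ φ t₀)) := by
    rw [hop, hφ.initial, hψ, star_one, one_smul]
  have hlim := hφ.tendsto_overlap hψ
  constructor
  · refine fun h => h.of_norm_le h₀.symm two_pos ?_
    filter_upwards [hlim.eventually_const_lt (show (1 / 4 : ℝ) < 1 by norm_num)] with t ht w
    rw [hnorm]
    have : 1 / 2 ≤ ‖star (φ t) ⬝ᵥ ψ‖ := by nlinarith [norm_nonneg (star (φ t) ⬝ᵥ ψ)]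
    nlinarith [norm_nonneg (adjointOp (coeffMatrix (V *ᵥ φ t)) w)]
  · refine fun h => h.of_norm_le h₀ two_pos ?_
    filter_upwards [hlim.eventually_lt_const (show (1 : ℝ) < 4 by norm_num)] with t ht w
    rw [hnorm]
    have : ‖star (φ t) ⬝ᵥ ψ‖ ≤ 2 := by nlinarith [norm_nonneg (star (φ t) ⬝ᵥ ψ)]
    gcongr

/-- Tangency means that the adjoint of the tangent vector maps the kernel of `X†` to the range of
`X†`, which is the orthogonal complement of the kernel of `X`. -/
lemma isRankTangent_iff_forall_exists [DecidableEq b] {X Y : Matrix b e ℂ} {c : ℂ} (hc : c ≠ 0) :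
    IsRankTangent X Y ↔
      ∀ u, adjointOp X u = 0 → ∃ w, adjointOp X w = adjointOp (c • Y) u := by
  classical
  constructor
  · intro h u hu
    have hu' : Xᴴ *ᵥ u.ofLp = 0 := congrArg WithLp.ofLp hu
    refine ⟨WithLp.toLp 2 (pseudoInv (X * Xᴴ) *ᵥ (X *ᵥ ((c • Y)ᴴ *ᵥ u.ofLp))), ?_⟩
    rw [adjointOp_apply, adjointOp_apply]
    congr 1
    rw [isRankTangent_iff_mul_eq_zero (mul_rightKerProj X)
      fun v hv => ⟨v, rightKerProj_mulVec hv⟩] at h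
    have h2 := congrArg conjTranspose h
    rw [conjTranspose_mul, conjTranspose_mul, conjTranspose_zero, (kerProj_isHermitian _).eq,
      (rightKerProj_isHermitian _).eq, ← Matrix.mul_assoc] at h2
    have h3 : rightKerProj X *ᵥ ((c • Y)ᴴ *ᵥ u.ofLp) = 0 := by
      rw [conjTranspose_smul, smul_mulVec, mulVec_smul]
      conv_lhs => rw [← kerProj_mulVec_of_conjTranspose hu']
      rw [mulVec_mulVec, mulVec_mulVec, h2, zero_mulVec, smul_zero]
    rw [rightKerProj, sub_mulVec, one_mulVec, sub_eq_zero] at h3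
    refine Eq.trans ?_ h3.symm
    simp only [mulVec_mulVec, Matrix.mul_assoc]
  · intro h u v hu hv
    obtain ⟨w, hw⟩ := h (WithLp.toLp 2 u) (congrArg (WithLp.toLp 2) hu)
    have hw' : Xᴴ *ᵥ w.ofLp = (c • Y)ᴴ *ᵥ u := congrArg WithLp.ofLp hw
    have h1 : star ((c • Y)ᴴ *ᵥ u) ⬝ᵥ v = 0 := by
      rw [← hw', star_mulVec_dotProduct, conjTranspose_conjTranspose, hv, dotProduct_zero]
    rw [star_mulVec_dotProduct, conjTranspose_conjTranspose, smul_mulVec, dotProduct_smul,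
      smul_eq_zero] at h1
    exact h1.resolve_left hc

theorem IsEvolution.isRankTangent_iff_kernelPersists [DecidableEq b] (hφ : IsEvolution H φ t₀ ψ)
    (hψ : star ψ ⬝ᵥ ψ = 1) (hξ : ξ = H *ᵥ ψ - expVal H ψ • ψ)
    (V : Matrix (b × e) a ℂ) :
    IsRankTangent (coeffMatrix (V *ᵥ ψ)) (coeffMatrix (V *ᵥ ξ)) ↔
      KernelPersists (fun t => adjointOp (coeffMatrix (V *ᵥ φ t))) t₀ := by
  rw [← hφ.kernelPersists_iff hψ V,
    NoisyClock.kernelPersists_iff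
      (hasDerivAt_adjointOp (hφ.hasDerivAt_coeffMatrix hψ hξ V)),
    isRankTangent_iff_forall_exists (neg_ne_zero.mpr Complex.I_ne_zero)]
  have h₀ : ketbra (φ t₀) (φ t₀) *ᵥ ψ = ψ := by
    rw [hφ.initial, ketbra_mulVec, hψ, one_smul]
  rw [h₀]

end Evolution

/-! ### Change of rank -/

section RankChange

variable {b e : Type*} [Fintype b] [DecidableEq b] [Fintype e]

theorem kernelPersists_iff_noRankChange {X : ℝ → Matrix b e ℂ} {t₀ : ℝ} :
    KernelPersists (fun t => adjointOp (X t)) t₀ ↔ NoRankChange (fun t => X t * (X t)ᴴ) t₀ := by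
  have hX := fun t => isHermitian_mul_conjTranspose_self (X t)
  have hp := fun t => charpoly_eq_prod_sortedEigenvalue (hX t)
  rw [kernelPersists_iff_eigenvalues (p := fun k t => sortedEigenvalue (X t * (X t)ᴴ) k)
    (Eventually.of_forall hp)]
  · exact forall₂_congr fun k hk => (hasSecondDerivAt_zero_iff hk
      (Eventually.of_forall fun t => nonneg_of_charpoly_eq (hp t) k)).symm
  · refine Eventually.of_forall fun t k l hkl => sortedEigenvalue_antitone (hX t) ?_
    exact le_of_not_ge fun h => absurd (sortedEigenvalue_antitone (hX t₀) h) (not_le.mpr hkl)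

theorem kernelPersists_iff_deriv_deriv {X : ℝ → Matrix b e ℂ} {t₀ : ℝ} {p : b → ℝ → ℝ}
    (hp : IsEigenvalueFamily (fun t => X t * (X t)ᴴ) t₀ p) :
    KernelPersists (fun t => adjointOp (X t)) t₀ ↔
      ∀ k, p k t₀ = 0 → deriv (deriv (p k)) t₀ = 0 := by
  rw [kernelPersists_iff_eigenvalues hp.charpoly_eq]
  · exact forall₂_congr fun k hk => (deriv_deriv_eq_zero_iff (hp.twiceDiff k) hk
      (hp.charpoly_eq.mono fun t ht => nonneg_of_charpoly_eq ht k)).symm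
  · have hc : ∀ k, ContinuousAt (p k) t₀ := fun k =>
      (hp.twiceDiff k).1.self_of_nhds.continuousAt
    simp only [eventually_all]
    intro k l hkl
    filter_upwards [(hc k).eventually_lt (hc l) hkl] with t ht using ht.le

end RankChange

end NoisyClock

theorem propositionz
    {a b e κ d : Type*} [Fintype a] [Fintype b] [DecidableEq b] [Fintype e] [DecidableEq e]
    [Fintype κ] [Fintype d] [DecidableEq d]
    (N : Matrix a a ℂ →ₗ[ℂ] Matrix b b ℂ) (hN : IsQuantumOperation N)
    (V : Matrix (b × e) a ℂ) (hV : IsStinespring N V)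
    (K : κ → Matrix b a ℂ) (hK : IsKraus N K)
    (ψ ξ : a → ℂ) (hψ : star ψ ⬝ᵥ ψ = 1) (hψξ : star ψ ⬝ᵥ ξ = 0) :
    List.TFAE
      [ ProjectionCondition N V ψ ξ,
        SchurCondition N ψ ξ,
        SchurCondition (complementary V) ψ ξ,
        KrausCondition N K ψ ξ ] ∧
    (∀ R : EntangledRep V ψ ξ (N (ketbra ψ ψ)) d,
      ProjectionCondition N V ψ ξ ↔ PolarCondition R) ∧
    ∀ (H : Matrix a a ℂ) (φ : ℝ → a → ℂ) (t₀ : ℝ), H.IsHermitian → IsEvolution H φ t₀ ψ →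
      ξ = H *ᵥ ψ - expVal H ψ • ψ →
      (ProjectionCondition N V ψ ξ ↔ NoRankChange (fun t => N (ketbra (φ t) (φ t))) t₀) ∧
      ∀ p : b → ℝ → ℝ, IsEigenvalueFamily (fun t => N (ketbra (φ t) (φ t))) t₀ p →
        (ProjectionCondition N V ψ ξ ↔ ∀ k, p k t₀ = 0 → deriv (deriv (p k)) t₀ = 0) := by
  refine ⟨?_, fun R => ?_, fun H φ t₀ hH hφ hξ => ?_⟩
  · have h12 : ProjectionCondition N V ψ ξ ↔ SchurCondition N ψ ξ :=
      (projectionCondition_iff hV).trans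
        (schurCondition_iff (C := fun x => coeffMatrix (V *ᵥ x)) hV.apply_ketbra).symm
    have h13 : ProjectionCondition N V ψ ξ ↔ SchurCondition (complementary V) ψ ξ :=
      (projectionCondition_iff hV).trans <| isRankTangent_transpose_iff.symm.trans
        (schurCondition_iff (C := fun x => (coeffMatrix (V *ᵥ x))ᵀ)
          (complementary_ketbra V)).symm
    have h24 : SchurCondition N ψ ξ ↔ KrausCondition N K ψ ξ :=
      (schurCondition_iff hK.apply_ketbra).trans (krausCondition_iff hK).symm
    tfae_have 1 ↔ 2 := h12
    tfae_have 1 ↔ 3 := h13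
    tfae_have 2 ↔ 4 := h24
    tfae_finish
  · rw [projectionCondition_iff hV, polarCondition_iff (hV.apply_ketbra ψ ψ) R]
  · have hρ : (fun t => N (ketbra (φ t) (φ t))) =
        fun t => coeffMatrix (V *ᵥ φ t) * (coeffMatrix (V *ᵥ φ t))ᴴ :=
      funext fun t => hV.apply_ketbra _ _
    rw [projectionCondition_iff hV, hφ.isRankTangent_iff_kernelPersists hψ hξ V, hρ]
    exact ⟨kernelPersists_iff_noRankChange, fun p hp => kernelPersists_iff_deriv_deriv hp⟩
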